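/- Let $\alpha,\beta\in\mathbb R$ with $\beta>0$ and $g:=\tfrac12+\tfrac{\alpha}{\beta}>0$. For $n\ge 0$ let $\mathcal E(\mathbb R^n)$ be the space of smooth functions $\phi:\mathbb R^n\to\mathbb C$ such that for every multi-index $k$ there are $a,b\ge 0$ with $|\partial^k\phi(x)|\le a\,e^{b(|x_1|+\dots+|x_n|)}$ for all $x$. Let $$L_j(u)=\begin{pmatrix}u+i\partial_{x_j}&e^{-x_j}\\-e^{x_j}&0\end{pmatrix},\quad K(u)=\begin{pmatrix}-\alpha&u-\frac i2\\-\beta^2(u-\frac i2)&-\alpha\end{pmatrix},\quad \sigma_2=\begin{pmatrix}0&-i\\i&0\end{pmatrix},$$ and let $\mathbb D_n(u)$ be the lower right entry of the operator-valued matrix $L_n(u)\cdots L_1(u)\,K(u)\,\sigma_2L_1^t(-u)\cdots L_n^t(-u)\sigma_2$; it acts on $\mathcal E(\mathbb R^n)$. For $v\in\mathbb C$ and $a\neq j$ define, writing only the variables that are acted upon, $$[\mathcal R_{ja}(v)\phi](x_j,x_a)=\int_{\mathbb R}e^{iv(x_j-y)-e^{x_j-y}-e^{y-x_a}}\,\phi(y,x_j)\,dy,\qquad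 \mathcal R^*_{ja}(v)=r_j\,\mathcal R_{ja}(v)\,r_j,\quad r_j:x_j\mapsto -x_j,$$ $$[\mathcal K_a(v)\phi](x_a)=\frac{(2\beta)^{iv}}{\Gamma(g-iv)}\int_{\ln\beta}^\infty e^{-2ivy-e^{y-x_a}}(1+\beta e^{-y})^{-iv-g}(1-\beta e^{-y})^{-iv+g-1}\phi(-y)\,dy .$$ For $n\ge1$ the raising operator is $$\boldsymbol{\Lambda}_n(v)=e^{ivx_n}\,\mathcal R_{n-1,n}(v)\cdots\mathcal R_{1n}(v)\,\mathcal K_n(v)\,\mathcal R^*_{1n}(v)\cdots\mathcal R^*_{n-1,n}(v),$$ applied to functions $\phi(x_1,\dots,x_{n-1})$ regarded as functions of $(x_1,\dots,x_n)$ not depending on $x_n$. Let $n\ge1$ and $u\in\mathbb C$ with $\operatorname{Im}u>1-g$. Then for $v=u$ and $v=u-i$ the operators $\mathcal K_n(v)$, $\mathcal R_{jn}(v)$ and $\mathcal R_{jn}^*(v)$ $(1\le j\le n-1)$ are well defined on $\mathcal E(\mathbb R^n)$ (by integrals that converge absolutely at every point) and map it to itself; $\boldsymbol{\Lambda}_n(u)$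 and $\boldsymbol{\Lambda}_n(u-i)$ map $\mathcal E(\mathbb R^{n-1})$ to $\mathcal E(\mathbb R^n)$; and for every $\phi\in\mathcal E(\mathbb R^{n-1})$ $$\mathbb D_n(u)\,\boldsymbol{\Lambda}_n(u)\,\phi=-\beta\,(g+iu)\,\boldsymbol{\Lambda}_n(u-i)\,\phi .$$ -/

import Mathlib

open scoped ContDiff

noncomputable section

namespace BCToda

/-! ### Exponentially tempered functions -/

/-- The partial derivative `∂_{x_j}`. -/
def partialDeriv {n : ℕ} (j : Fin n) (φ : (Fin n → ℝ) → ℂ) : (Fin n → ℝ) → ℂ :=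
  fun x => fderiv ℝ φ x (Pi.single j 1)

/-- The mixed partial derivative of `φ` along the list of coordinates `l`, the head of the list
being differentiated first. On smooth functions the order is immaterial, and every
`∂_{x_1}^{k_1} ⋯ ∂_{x_n}^{k_n}` is of this form. -/
def mixedDeriv {n : ℕ} : List (Fin n) → ((Fin n → ℝ) → ℂ) → ((Fin n → ℝ) → ℂ)
  | [], φ => φ
  | j :: l, φ => mixedDeriv l (partialDeriv j φ)

/-- `|f x| ≤ a * exp (b * (|x_1| + ⋯ + |x_n|))` for some constants `a, b ≥ 0`. -/
def ExpBounded {n : ℕ} (f : (Fin n → ℝ) → ℂ) : Prop :=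
  ∃ a b : ℝ, 0 ≤ a ∧ 0 ≤ b ∧ ∀ x, ‖f x‖ ≤ a * Real.exp (b * ∑ i, |x i|)

/-- A smooth function which is exponentially bounded together with all its derivatives. -/
def IsExpTempered {n : ℕ} (φ : (Fin n → ℝ) → ℂ) : Prop :=
  ContDiff ℝ ∞ φ ∧ ∀ l : List (Fin n), ExpBounded (mixedDeriv l φ)

theorem contDiff_partialDeriv {n : ℕ} (j : Fin n) {φ : (Fin n → ℝ) → ℂ}
    (h : ContDiff ℝ ∞ φ) : ContDiff ℝ ∞ (partialDeriv j φ) := by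
  have h1 : ContDiff ℝ ∞ (fderiv ℝ φ) := h.fderiv_right (by simp)
  exact h1.clm_apply contDiff_const

theorem partialDeriv_add {n : ℕ} (j : Fin n) {φ ψ : (Fin n → ℝ) → ℂ}
    (hφ : ContDiff ℝ ∞ φ) (hψ : ContDiff ℝ ∞ ψ) :
    partialDeriv j (φ + ψ) = partialDeriv j φ + partialDeriv j ψ := by
  funext x
  have h1 := (hφ.differentiable (by simp)) x
  have h2 := (hψ.differentiable (by simp)) x
  simp [partialDeriv, fderiv_add h1 h2]

theorem partialDeriv_smul {n : ℕ} (j : Fin n) (c : ℂ) {φ : (Fin n → ℝ) → ℂ}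
    (hφ : ContDiff ℝ ∞ φ) : partialDeriv j (c • φ) = c • partialDeriv j φ := by
  funext x
  have h1 := (hφ.differentiable (by simp)) x
  simp [partialDeriv, fderiv_const_smul h1 c]

theorem mixedDeriv_add {n : ℕ} (l : List (Fin n)) : ∀ {φ ψ : (Fin n → ℝ) → ℂ},
    ContDiff ℝ ∞ φ → ContDiff ℝ ∞ ψ → mixedDeriv l (φ + ψ) = mixedDeriv l φ + mixedDeriv l ψ := by
  induction l with
  | nil => intros; rfl
  | cons j l ih =>
    intro φ ψ hφ hψ
    simp only [mixedDeriv]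
    rw [partialDeriv_add j hφ hψ, ih (contDiff_partialDeriv j hφ) (contDiff_partialDeriv j hψ)]

theorem mixedDeriv_smul {n : ℕ} (c : ℂ) (l : List (Fin n)) : ∀ {φ : (Fin n → ℝ) → ℂ},
    ContDiff ℝ ∞ φ → mixedDeriv l (c • φ) = c • mixedDeriv l φ := by
  induction l with
  | nil => intros; rfl
  | cons j l ih =>
    intro φ hφ
    simp only [mixedDeriv]
    rw [partialDeriv_smul j c hφ, ih (contDiff_partialDeriv j hφ)]

theorem mixedDeriv_zero {n : ℕ} (l : List (Fin n)) :
    mixedDeriv l (0 : (Fin n → ℝ) → ℂ) = 0 := by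
  have h := mixedDeriv_smul (0 : ℂ) l (φ := (0 : (Fin n → ℝ) → ℂ)) contDiff_const
  simpa using h

theorem ExpBounded.add {n : ℕ} {f g : (Fin n → ℝ) → ℂ} (hf : ExpBounded f)
    (hg : ExpBounded g) : ExpBounded (f + g) := by
  obtain ⟨a, b, ha, hb, h⟩ := hf
  obtain ⟨a', b', ha', hb', h'⟩ := hg
  refine ⟨a + a', b + b', by positivity, by positivity, fun x => ?_⟩
  have hs : 0 ≤ ∑ i, |x i| := Finset.sum_nonneg fun i _ => abs_nonneg _
  calc ‖(f + g) x‖ ≤ ‖f x‖ + ‖g x‖ := norm_add_le _ _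
    _ ≤ a * Real.exp (b * ∑ i, |x i|) + a' * Real.exp (b' * ∑ i, |x i|) :=
        add_le_add (h x) (h' x)
    _ ≤ a * Real.exp ((b + b') * ∑ i, |x i|) + a' * Real.exp ((b + b') * ∑ i, |x i|) := by
        gcongr <;> linarith
    _ = (a + a') * Real.exp ((b + b') * ∑ i, |x i|) := by ring

theorem ExpBounded.smul {n : ℕ} (c : ℂ) {f : (Fin n → ℝ) → ℂ} (hf : ExpBounded f) :
    ExpBounded (c • f) := by
  obtain ⟨a, b, ha, hb, h⟩ := hf
  refine ⟨‖c‖ * a, b, by positivity, hb, fun x => ?_⟩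
  rw [Pi.smul_apply, norm_smul, mul_assoc]
  exact mul_le_mul_of_nonneg_left (h x) (norm_nonneg c)

/-- The space `𝓔(ℝⁿ)` of exponentially tempered functions. -/
def expTempered (n : ℕ) : Submodule ℂ ((Fin n → ℝ) → ℂ) where
  carrier := {φ | IsExpTempered φ}
  zero_mem' := ⟨contDiff_const, fun l => by
    rw [mixedDeriv_zero]
    exact ⟨0, 0, le_rfl, le_rfl, fun x => by simp⟩⟩
  add_mem' := fun {φ ψ} hφ hψ => ⟨hφ.1.add hψ.1, fun l => by
    rw [mixedDeriv_add l hφ.1 hψ.1]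
    exact (hφ.2 l).add (hψ.2 l)⟩
  smul_mem' := fun c φ hφ => ⟨contDiff_const.smul hφ.1, fun l => by
    rw [mixedDeriv_smul c l hφ.1]
    exact (hφ.2 l).smul c⟩

theorem partialDeriv_mem {n : ℕ} (j : Fin n) {φ : (Fin n → ℝ) → ℂ}
    (h : φ ∈ expTempered n) : partialDeriv j φ ∈ expTempered n :=
  ⟨contDiff_partialDeriv j h.1, fun l => h.2 (j :: l)⟩

/-- Multiplication by `e^{s x_j}`. -/
def expMul {n : ℕ} (s : ℝ) (j : Fin n) (φ : (Fin n → ℝ) → ℂ) : (Fin n → ℝ) → ℂ :=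
  fun x => (Real.exp (s * x j) : ℂ) * φ x

theorem contDiff_expMul {n : ℕ} (s : ℝ) (j : Fin n) {φ : (Fin n → ℝ) → ℂ}
    (h : ContDiff ℝ ∞ φ) : ContDiff ℝ ∞ (expMul s j φ) := by
  have h1 : ContDiff ℝ ∞ (fun x : Fin n → ℝ => Real.exp (s * x j)) := by fun_prop
  exact (Complex.ofRealCLM.contDiff.comp h1).mul h

theorem partialDeriv_expMul {n : ℕ} (s : ℝ) (j i : Fin n) {φ : (Fin n → ℝ) → ℂ}
    (h : ContDiff ℝ ∞ φ) : partialDeriv i (expMul s j φ) =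
      expMul s j (((if i = j then s else 0 : ℝ) : ℂ) • φ + partialDeriv i φ) := by
  funext x
  have h1 : HasFDerivAt (fun x : Fin n → ℝ => s * x j)
      (s • (ContinuousLinearMap.proj j : (Fin n → ℝ) →L[ℝ] ℝ)) x :=
    ((ContinuousLinearMap.proj j : (Fin n → ℝ) →L[ℝ] ℝ).hasFDerivAt).const_mul s
  have h2 := Complex.ofRealCLM.hasFDerivAt.comp x h1.exp
  have h3 := h2.mul ((h.differentiable (by simp)) x).hasFDerivAt
  have h4 : fderiv ℝ (expMul s j φ) x = _ := h3.fderiv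
  have h6 : partialDeriv i φ x = fderiv ℝ φ x (Pi.single i 1) := rfl
  have h7 : partialDeriv i (expMul s j φ) x = fderiv ℝ (expMul s j φ) x (Pi.single i 1) := rfl
  rw [h7, h4]
  simp only [expMul, Pi.add_apply, h6]
  by_cases hij : i = j
  · subst hij
    simp
    ring
  · simp [hij]

theorem ExpBounded.expMul {n : ℕ} (s : ℝ) (j : Fin n) {f : (Fin n → ℝ) → ℂ}
    (hf : ExpBounded f) : ExpBounded (expMul s j f) := by
  obtain ⟨a, b, ha, hb, h⟩ := hf
  refine ⟨a, |s| + b, ha, by positivity, fun x => ?_⟩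
  have hs : |x j| ≤ ∑ i, |x i| :=
    Finset.single_le_sum (f := fun i => |x i|) (fun i _ => abs_nonneg _) (Finset.mem_univ j)
  have h1 : s * x j ≤ |s| * ∑ i, |x i| :=
    (le_abs_self _).trans ((abs_mul s (x j)).le.trans
      (mul_le_mul_of_nonneg_left hs (abs_nonneg s)))
  have h2 : ‖BCToda.expMul s j f x‖ = Real.exp (s * x j) * ‖f x‖ := by
    simp only [BCToda.expMul, norm_mul, Complex.norm_real, Real.norm_eq_abs, Real.abs_exp]
  calc ‖BCToda.expMul s j f x‖ = Real.exp (s * x j) * ‖f x‖ := h2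
    _ ≤ Real.exp (|s| * ∑ i, |x i|) * (a * Real.exp (b * ∑ i, |x i|)) := by
        gcongr
        exact h x
    _ = a * Real.exp ((|s| + b) * ∑ i, |x i|) := by
        rw [add_mul, Real.exp_add]; ring

theorem expMul_mem {n : ℕ} (s : ℝ) (j : Fin n) {φ : (Fin n → ℝ) → ℂ}
    (h : φ ∈ expTempered n) : expMul s j φ ∈ expTempered n := by
  refine ⟨contDiff_expMul s j h.1, fun l => ?_⟩
  induction l generalizing φ with
  | nil => exact (h.2 []).expMul s j
  | cons i l ih =>
    simp only [mixedDeriv]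
    rw [partialDeriv_expMul s j i h.1]
    exact ih ((expTempered n).add_mem ((expTempered n).smul_mem _ h) (partialDeriv_mem i h))

/-- The operator `∂_{x_j}` on `𝓔(ℝⁿ)`. -/
def derivE {n : ℕ} (j : Fin n) : Module.End ℂ (expTempered n) where
  toFun φ := ⟨partialDeriv j φ.1, partialDeriv_mem j φ.2⟩
  map_add' φ ψ := Subtype.ext (partialDeriv_add j φ.2.1 ψ.2.1)
  map_smul' c φ := Subtype.ext (partialDeriv_smul j c φ.2.1)

/-- The operator of multiplication by `e^{s x_j}` on `𝓔(ℝⁿ)`. -/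
def expE {n : ℕ} (s : ℝ) (j : Fin n) : Module.End ℂ (expTempered n) where
  toFun φ := ⟨expMul s j φ.1, expMul_mem s j φ.2⟩
  map_add' _ _ := Subtype.ext (funext fun _ => mul_add _ _ _)
  map_smul' _ _ := Subtype.ext (funext fun _ => mul_left_comm _ _ _)

/-! ### Lax matrices and the monodromy matrix -/

/-- `2 × 2` matrices whose entries are operators on `𝓔(ℝⁿ)`; they are multiplied as matrices
over the (noncommutative) ring of operators. -/
abbrev OpMatrix (n : ℕ) : Type := Matrix (Fin 2) (Fin 2) (Module.End ℂ (expTempered n))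

/-- A matrix of numbers, viewed as a matrix of scalar operators. -/
def scalarMatrix (n : ℕ) (A : Matrix (Fin 2) (Fin 2) ℂ) : OpMatrix n :=
  A.map (algebraMap ℂ (Module.End ℂ (expTempered n)))

/-- The Pauli matrix `σ₂`. -/
def sigma2 : Matrix (Fin 2) (Fin 2) ℂ := !![0, -Complex.I; Complex.I, 0]

/-- The Toda Lax matrix `L_j(u)`. -/
def toda {n : ℕ} (j : Fin n) (u : ℂ) : OpMatrix n :=
  !![algebraMap ℂ _ u + Complex.I • derivE j, expE (-1) j;
     -expE 1 j, 0]

/-- The matrix `σ₂ L_j(-u)ᵗ σ₂`. -/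
def todaTilde {n : ℕ} (j : Fin n) (u : ℂ) : OpMatrix n :=
  scalarMatrix n sigma2 * (toda j (-u)).transpose * scalarMatrix n sigma2

/-- The boundary matrix `K(u)`. -/
def boundaryK (α β : ℝ) (u : ℂ) : Matrix (Fin 2) (Fin 2) ℂ :=
  !![-(α : ℂ), u - Complex.I / 2;
     -((β : ℂ) ^ 2 * (u - Complex.I / 2)), -(α : ℂ)]

/-- The monodromy matrix of the first `k` particles
`L_k(u) ⋯ L_1(u) K(u) σ₂ L_1(-u)ᵗ ⋯ L_k(-u)ᵗ σ₂`, acting on functions of `n ≥ k` variables.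
(The particle with number `k + 1` has the index `k` in `Fin n`.) -/
def monodromy {n : ℕ} (α β : ℝ) (u : ℂ) : (k : ℕ) → k ≤ n → OpMatrix n
  | 0, _ => scalarMatrix n (boundaryK α β u)
  | k + 1, h => toda ⟨k, h⟩ u * monodromy α β u k (Nat.le_of_succ_le h) * todaTilde ⟨k, h⟩ u

/-- The entry `𝔻_n(u)` (second row, second column) of the monodromy matrix of `n` particles. -/
def opD (α β : ℝ) (n : ℕ) (u : ℂ) : Module.End ℂ (expTempered n) :=
  monodromy α β u n le_rfl 1 1

/-! ### Integral operators -/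

/-- The parameter `g = 1/2 + α/β`. -/
def gPar (α β : ℝ) : ℝ := 1 / 2 + α / β

/-- The integrand, as a function of `y`, of `[𝓡_{ja}(v) φ](x)`, where `j ≠ a`. -/
def rIntegrand {n : ℕ} (j a : Fin n) (v : ℂ) (φ : (Fin n → ℝ) → ℂ) (x : Fin n → ℝ) (y : ℝ) : ℂ :=
  Complex.exp (Complex.I * v * ((x j - y : ℝ) : ℂ)
      - (Real.exp (x j - y) : ℂ) - (Real.exp (y - x a) : ℂ))
    * φ (Function.update (Function.update x j y) a (x j))

/-- The operator `𝓡_{ja}(v)`: in the variables `(x_j, x_a)` it is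
`φ ↦ ∫ exp (i v (x_j - y) - e^{x_j - y} - e^{y - x_a}) φ(y, x_j) dy`. -/
def rOp {n : ℕ} (j a : Fin n) (v : ℂ) (φ : (Fin n → ℝ) → ℂ) : (Fin n → ℝ) → ℂ :=
  fun x => ∫ y : ℝ, rIntegrand j a v φ x y

/-- The reflection `r_j` of the coordinate `x_j`. -/
def reflect {n : ℕ} (j : Fin n) (φ : (Fin n → ℝ) → ℂ) : (Fin n → ℝ) → ℂ :=
  fun x => φ (Function.update x j (-x j))

/-- The reflected operator `𝓡*_{ja}(v) = r_j 𝓡_{ja}(v) r_j`. -/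
def rStarOp {n : ℕ} (j a : Fin n) (v : ℂ) (φ : (Fin n → ℝ) → ℂ) : (Fin n → ℝ) → ℂ :=
  reflect j (rOp j a v (reflect j φ))

/-- The integrand, as a function of `y > log β`, of the reflection operator. -/
def kIntegrand {n : ℕ} (α β : ℝ) (a : Fin n) (v : ℂ) (φ : (Fin n → ℝ) → ℂ) (x : Fin n → ℝ)
    (y : ℝ) : ℂ :=
  Complex.exp (-2 * Complex.I * v * (y : ℂ) - (Real.exp (y - x a) : ℂ))
    * ((1 + β * Real.exp (-y) : ℝ) : ℂ) ^ (-Complex.I * v - (gPar α β : ℂ))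
    * ((1 - β * Real.exp (-y) : ℝ) : ℂ) ^ (-Complex.I * v + (gPar α β : ℂ) - 1)
    * φ (Function.update x a (-y))

/-- The reflection operator `𝓚_a(v)`. -/
def kOp {n : ℕ} (α β : ℝ) (a : Fin n) (v : ℂ) (φ : (Fin n → ℝ) → ℂ) : (Fin n → ℝ) → ℂ :=
  fun x => ((2 * β : ℝ) : ℂ) ^ (Complex.I * v) / Complex.Gamma ((gPar α β : ℂ) - Complex.I * v)
    * ∫ y in Set.Ioi (Real.log β), kIntegrand α β a v φ x y

/-- The monodromy operator
`𝓡_{ka}(v) ⋯ 𝓡_{1a}(v) 𝓚_a(v) 𝓡*_{1a}(v) ⋯ 𝓡*_{ka}(v)` on functions of `n ≥ k` variables. -/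
def monodromyOp {n : ℕ} (α β : ℝ) (a : Fin n) (v : ℂ) :
    (k : ℕ) → k ≤ n → ((Fin n → ℝ) → ℂ) → ((Fin n → ℝ) → ℂ)
  | 0, _ => kOp α β a v
  | k + 1, h =>
      rOp ⟨k, h⟩ a v ∘ monodromyOp α β a v k (Nat.le_of_succ_le h) ∘ rStarOp ⟨k, h⟩ a v

/-- The raising operator for `n + 1` particles: with `a = n + 1` the last coordinate,
`e^{i λ x_{n+1}} 𝓡_{n,a}(λ) ⋯ 𝓡_{1,a}(λ) 𝓚_a(λ) 𝓡*_{1,a}(λ) ⋯ 𝓡*_{n,a}(λ)` restricted to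
functions `φ(x_1, …, x_n)` that do not depend on `x_{n+1}`. -/
def raising (α β : ℝ) (n : ℕ) (lam : ℂ) (φ : (Fin n → ℝ) → ℂ) : (Fin (n + 1) → ℝ) → ℂ :=
  fun x => Complex.exp (Complex.I * lam * (x (Fin.last n) : ℂ))
    * monodromyOp α β (Fin.last n) lam n (Nat.le_succ n)
        (fun z => φ (fun i => z i.castSucc)) x

/-- All the integral operators in the raising operator with parameter `v` for `n + 1` particles
are well defined on `𝓔(ℝ^{n+1})`: the integrals converge absolutely at every point, and the
results are again in `𝓔(ℝ^{n+1})`. (For `𝓡*_{ja}(v) = r_j 𝓡_{ja}(v) r_j` this is contained in the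
clause for `𝓡_{ja}(v)`.) -/
def RaisingWellDefined (α β : ℝ) (n : ℕ) (v : ℂ) : Prop :=
  ∀ ψ ∈ expTempered (n + 1),
    ((∀ x, MeasureTheory.IntegrableOn (kIntegrand α β (Fin.last n) v ψ x)
        (Set.Ioi (Real.log β))) ∧
      kOp α β (Fin.last n) v ψ ∈ expTempered (n + 1)) ∧
    ∀ j : Fin n,
      (∀ x, MeasureTheory.Integrable (rIntegrand j.castSucc (Fin.last n) v ψ x)) ∧
      rOp j.castSucc (Fin.last n) v ψ ∈ expTempered (n + 1)

end BCToda

end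

/-! The identity follows algebraically from a few exchange relations in the ring of operators on 𝓔;
analysis only shows that the integral operators lie in this ring and justifies two integrations by
parts.

Let x_a be the last coordinate, A, B, C, D the entries of the monodromy matrix of the particles
before it, and M(u) the operator `monodromyE`. Multiplying out the last Lax matrices gives 𝔻(u) =
−e^{x_a}(−A e^{−x_a} + B(−u + i∂_a)). Conjugation by e^{iux_a} shifts i∂_a by −u and turns this into
e^{x_a}w with w = A e^{−x_a} + B(2u − i∂_a) (`rowW`). As e^{iux_a}e^{x_a} = e^{i(u−i)x_a}, it
remains to see that w M(u) = c M(u−i), c = −β(g+iu), on functions independent of x_a.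

To make this inductive in the number of particles, `Intertwines` allows in it a further term ending
in e^{x_a}∂_a, which kills functions independent of x_a, and adds a homogeneous relation of the same
shape for two more operators `opK` and `opH`. A new particle replaces M by R M S with R = 𝓡_{ja}(u),
S = 𝓡*_{ja}(u). Moving everything through R expresses the new operators by the old ones
(`rowV_next_top`, `rowW_next_top`, `opK_next`, `opH_next`), and S = e^{x_a}∂_a e^{x_j}𝓡*_{ja}(u−i)
supplies the right factor that the old relations need (`intertwines_next`). The relations for 𝓡 come
from differentiating its kernel, from the kernel ratio under v ↦ v−i, and from integration by parts
over ℝ.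

The base case `intertwines_boundary` uses the derivative of 𝓚 in x_a, the fact that its weight gains
the factor e^{2y}−β² from u−i to u, and integration by parts over (ln β, ∞). The condition Im u >
1−g removes the boundary term at ln β and makes 𝓚(u−i) converge. The constant found, 2(β²(iu+½)²−α²)
= −2β²(g+iu)(g−iu−1), becomes c after normalisation.

For the analysis, `TemperedKernel` isolates what a kernel needs: logarithmic derivatives that act on
𝓔, and a bound integrable in y and exponential in x. The integrals then form a class closed under
differentiation, so they lie in 𝓔 (`mem_expTempered_of_closed`). -/

noncomputable section
namespace BCToda

/-! ### Membership criteria for `𝓔(ℝⁿ)` -/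

theorem clm_eq_sum_single {n : ℕ} (L : (Fin n → ℝ) →L[ℝ] ℂ) :
    L = ∑ i, (ContinuousLinearMap.proj i : (Fin n → ℝ) →L[ℝ] ℝ).smulRight (L (Pi.single i 1)) := by
  ext x
  conv_lhs => rw [pi_eq_sum_univ' x]
  simp [map_sum]

theorem fderiv_eq_sum_partialDeriv {n : ℕ} (f : (Fin n → ℝ) → ℂ) (x : Fin n → ℝ) :
    fderiv ℝ f x = ∑ i, (ContinuousLinearMap.proj i : (Fin n → ℝ) →L[ℝ] ℝ).smulRight
      (partialDeriv i f x) :=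
  clm_eq_sum_single _

theorem norm_clm_le_sum_single {n : ℕ} (L : (Fin n → ℝ) →L[ℝ] ℂ) :
    ‖L‖ ≤ ∑ i, ‖L (Pi.single i 1)‖ := by
  refine L.opNorm_le_bound (Finset.sum_nonneg fun i _ => norm_nonneg _) fun x => ?_
  conv_lhs => rw [pi_eq_sum_univ' x, map_sum]
  rw [Finset.sum_mul]
  refine (norm_sum_le _ _).trans (Finset.sum_le_sum fun i _ => ?_)
  rw [map_smul, norm_smul, mul_comm]
  exact mul_le_mul_of_nonneg_left (norm_le_pi_norm x i) (norm_nonneg _)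

/-- A set of exponentially bounded differentiable functions closed under partial derivatives
consists of elements of `𝓔(ℝⁿ)`. -/
theorem mem_expTempered_of_closed {n : ℕ} (S : Set ((Fin n → ℝ) → ℂ))
    (hd : ∀ f ∈ S, Differentiable ℝ f) (hb : ∀ f ∈ S, ExpBounded f)
    (hp : ∀ f ∈ S, ∀ i, partialDeriv i f ∈ S) {f : (Fin n → ℝ) → ℂ} (hf : f ∈ S) :
    f ∈ expTempered n := by
  -- The derivative of f is a finite combination of its partials, which lie in S again; so C^m for
  -- all of S at once gives C^{m+1}.
  have hc : ∀ m : ℕ, ∀ f ∈ S, ContDiff ℝ m f := by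
    intro m
    induction m with
    | zero => intro f hf; exact contDiff_zero.2 (hd f hf).continuous
    | succ m ih =>
      intro f hf
      push_cast
      rw [contDiff_succ_iff_fderiv]
      refine ⟨hd f hf, fun h => by simp at h, ?_⟩
      rw [funext (fderiv_eq_sum_partialDeriv f)]
      exact ContDiff.sum fun i _ => contDiff_const.smulRight (ih _ (hp f hf i))
  refine ⟨contDiff_infty.2 fun m => hc m f hf, fun l => ?_⟩
  induction l generalizing f with
  | nil => exact hb f hf
  | cons i l ih => exact ih (hp f hf i)

theorem differentiable_of_mem {n : ℕ} {φ : (Fin n → ℝ) → ℂ} (h : φ ∈ expTempered n) :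
    Differentiable ℝ φ := h.1.differentiable (by simp)

theorem continuous_of_mem {n : ℕ} {φ : (Fin n → ℝ) → ℂ} (h : φ ∈ expTempered n) :
    Continuous φ := h.1.continuous

theorem expBounded_of_mem {n : ℕ} {φ : (Fin n → ℝ) → ℂ} (h : φ ∈ expTempered n) :
    ExpBounded φ := h.2 []

/-! ### Linear changes of variables -/

theorem partialDeriv_comp_clm {n m : ℕ} (L : (Fin n → ℝ) →L[ℝ] (Fin m → ℝ))
    {φ : (Fin m → ℝ) → ℂ} (h : Differentiable ℝ φ) (i : Fin n) :
    partialDeriv i (φ ∘ L) = (∑ j, ((L (Pi.single i 1) j : ℝ) : ℂ) • partialDeriv j φ) ∘ L := by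
  funext x
  have h1 : HasFDerivAt (φ ∘ L) ((fderiv ℝ φ (L x)).comp L) x :=
    (h (L x)).hasFDerivAt.comp x L.hasFDerivAt
  simp only [partialDeriv, h1.fderiv, ContinuousLinearMap.comp_apply, Function.comp]
  conv_lhs => rw [pi_eq_sum_univ' (L (Pi.single i 1)), map_sum]
  simp [partialDeriv, Finset.sum_apply]

theorem ExpBounded.comp_clm {n m : ℕ} (L : (Fin n → ℝ) →L[ℝ] (Fin m → ℝ))
    {φ : (Fin m → ℝ) → ℂ} (h : ExpBounded φ) : ExpBounded (φ ∘ L) := by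
  obtain ⟨a, b, ha, hb, h⟩ := h
  refine ⟨a, b * (m * ‖L‖), ha, by positivity, fun x => (h (L x)).trans ?_⟩
  have h1 : ‖x‖ ≤ ∑ i, |x i| := by
    refine (pi_norm_le_iff_of_nonneg (Finset.sum_nonneg fun i _ => abs_nonneg _)).2 fun i => ?_
    exact Finset.single_le_sum (f := fun i => |x i|) (fun i _ => abs_nonneg _) (Finset.mem_univ i)
  have h2 : ∑ j, |L x j| ≤ m * ‖L‖ * ∑ i, |x i| := by
    calc ∑ j, |L x j| ≤ ∑ _j : Fin m, ‖L‖ * ‖x‖ :=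
          Finset.sum_le_sum fun j _ => (norm_le_pi_norm (L x) j).trans (L.le_opNorm x)
      _ = m * ‖L‖ * ‖x‖ := by simp [mul_assoc]
      _ ≤ _ := by gcongr
  rw [mul_assoc]
  gcongr

/-- By the chain rule the functions ψ ∘ L, with ψ tempered and L fixed, are closed under partial
derivatives. -/
theorem comp_clm_mem {n m : ℕ} (L : (Fin n → ℝ) →L[ℝ] (Fin m → ℝ)) {φ : (Fin m → ℝ) → ℂ}
    (h : φ ∈ expTempered m) : φ ∘ L ∈ expTempered n := by
  refine mem_expTempered_of_closed {f | ∃ φ ∈ expTempered m, f = φ ∘ L} ?_ ?_ ?_ ⟨φ, h, rfl⟩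
  · rintro _ ⟨φ, h, rfl⟩
    exact (differentiable_of_mem h).comp L.differentiable
  · rintro _ ⟨φ, h, rfl⟩
    exact (expBounded_of_mem h).comp_clm L
  · rintro _ ⟨φ, h, rfl⟩ i
    refine ⟨_, ?_, partialDeriv_comp_clm L (differentiable_of_mem h) i⟩
    exact Submodule.sum_mem _ fun j _ => Submodule.smul_mem _ _ (partialDeriv_mem j h)

/-- The change of variables `φ ↦ φ ∘ L`. -/
def pullE {n m : ℕ} (L : (Fin n → ℝ) →L[ℝ] (Fin m → ℝ)) : expTempered m →ₗ[ℂ] expTempered n where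
  toFun φ := ⟨φ.1 ∘ L, comp_clm_mem L φ.2⟩
  map_add' _ _ := rfl
  map_smul' _ _ := rfl

theorem derivE_pullE {n m : ℕ} (L : (Fin n → ℝ) →L[ℝ] (Fin m → ℝ)) (φ : expTempered m)
    (i : Fin n) : derivE i (pullE L φ) =
      pullE L (∑ j, ((L (Pi.single i 1) j : ℝ) : ℂ) • derivE j φ) := by
  apply Subtype.ext
  refine (partialDeriv_comp_clm L (differentiable_of_mem φ.2) i).trans ?_
  simp only [pullE, LinearMap.coe_mk, AddHom.coe_mk, Submodule.coe_sum, Submodule.coe_smul]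
  rfl

theorem expE_pullE {n m : ℕ} (L : (Fin n → ℝ) →L[ℝ] (Fin m → ℝ)) (φ : expTempered m)
    (s t : ℝ) (i : Fin n) (j : Fin m) (h : ∀ x, s * x i = t * L x j) :
    expE s i (pullE L φ) = pullE L (expE t j φ) := by
  apply Subtype.ext
  funext x
  change (Real.exp (s * x i) : ℂ) * φ.1 (L x) = (Real.exp (t * L x j) : ℂ) * φ.1 (L x)
  rw [h]

/-! ### Multiplication by complex exponentials -/

/-- Multiplication by `e^{c x_j}` with a complex `c`. -/
def cexpMul {n : ℕ} (c : ℂ) (j : Fin n) (φ : (Fin n → ℝ) → ℂ) : (Fin n → ℝ) → ℂ :=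
  fun x => Complex.exp (c * (x j : ℂ)) * φ x

theorem hasFDerivAt_cexp_coord {n : ℕ} (c : ℂ) (j : Fin n) (x : Fin n → ℝ) :
    HasFDerivAt (fun x : Fin n → ℝ => Complex.exp (c * (x j : ℂ)))
      (Complex.exp (c * (x j : ℂ)) • (c • (Complex.ofRealCLM.comp
        (ContinuousLinearMap.proj j : (Fin n → ℝ) →L[ℝ] ℝ)))) x := by
  have h1 : HasFDerivAt (fun x : Fin n → ℝ => (x j : ℂ)) (Complex.ofRealCLM.comp
      (ContinuousLinearMap.proj j : (Fin n → ℝ) →L[ℝ] ℝ)) x :=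
    (Complex.ofRealCLM.comp (ContinuousLinearMap.proj j : (Fin n → ℝ) →L[ℝ] ℝ)).hasFDerivAt
  exact (h1.const_mul c).cexp

theorem partialDeriv_cexpMul {n : ℕ} (c : ℂ) (j i : Fin n) {φ : (Fin n → ℝ) → ℂ}
    (h : Differentiable ℝ φ) : partialDeriv i (cexpMul c j φ) =
      cexpMul c j ((if i = j then c else 0) • φ + partialDeriv i φ) := by
  funext x
  have h3 := (hasFDerivAt_cexp_coord c j x).mul (h x).hasFDerivAt
  have h4 : fderiv ℝ (cexpMul c j φ) x = _ := h3.fderiv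
  have h6 : partialDeriv i φ x = fderiv ℝ φ x (Pi.single i 1) := rfl
  have h7 : partialDeriv i (cexpMul c j φ) x = fderiv ℝ (cexpMul c j φ) x (Pi.single i 1) := rfl
  rw [h7, h4]
  simp only [cexpMul, Pi.add_apply, h6]
  by_cases hij : i = j
  · subst hij
    simp
    ring
  · simp [hij]

theorem ExpBounded.cexpMul {n : ℕ} (c : ℂ) (j : Fin n) {f : (Fin n → ℝ) → ℂ}
    (hf : ExpBounded f) : ExpBounded (cexpMul c j f) := by
  obtain ⟨a, b, ha, hb, h⟩ := hf.expMul c.re j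
  refine ⟨a, b, ha, hb, fun x => le_trans (le_of_eq ?_) (h x)⟩
  simp [BCToda.cexpMul, BCToda.expMul, Complex.norm_exp, -Complex.ofReal_exp]

theorem cexpMul_mem {n : ℕ} (c : ℂ) (j : Fin n) {φ : (Fin n → ℝ) → ℂ}
    (h : φ ∈ expTempered n) : cexpMul c j φ ∈ expTempered n := by
  refine mem_expTempered_of_closed {f | ∃ φ ∈ expTempered n, f = cexpMul c j φ}
    ?_ ?_ ?_ ⟨φ, h, rfl⟩
  · rintro _ ⟨φ, h, rfl⟩ x
    exact ((hasFDerivAt_cexp_coord c j x).mul (differentiable_of_mem h x).hasFDerivAt).differentiableAt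
  · rintro _ ⟨φ, h, rfl⟩
    exact (expBounded_of_mem h).cexpMul c j
  · rintro _ ⟨φ, h, rfl⟩ i
    exact ⟨_, Submodule.add_mem _ (Submodule.smul_mem _ _ h) (partialDeriv_mem i h),
      partialDeriv_cexpMul c j i (differentiable_of_mem h)⟩

/-- The operator of multiplication by `e^{c x_j}` with a complex `c`. -/
def cexpE {n : ℕ} (c : ℂ) (j : Fin n) : Module.End ℂ (expTempered n) where
  toFun φ := ⟨cexpMul c j φ.1, cexpMul_mem c j φ.2⟩
  map_add' _ _ := Subtype.ext (funext fun _ => mul_add _ _ _)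
  map_smul' _ _ := Subtype.ext (funext fun _ => mul_left_comm _ _ _)

/-! ### Integral operators with tempered kernels -/

/-- A kernel `k(x, y)` which defines an operator `𝓔(ℝⁿ⁺¹) → 𝓔(ℝⁿ)` by integration over `y`;
its logarithmic derivative in `x_i` is the multiplication operator `q i`. -/
structure TemperedKernel {n : ℕ} (μ : MeasureTheory.Measure ℝ) (k : (Fin n → ℝ) → ℝ → ℂ)
    (q : Fin n → Module.End ℂ (expTempered (n + 1))) : Prop where
  diff : ∀ y, Differentiable ℝ fun x => k x y
  -- With `q i` acting on functions of (y, x), the derivative of an integral is again an integral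
  -- against the same kernel.
  deriv : ∀ i x y (ψ : expTempered (n + 1)),
    partialDeriv i (fun x => k x y) x * ψ.1 (Fin.cons y x) = k x y * (q i ψ).1 (Fin.cons y x)
  meas : ∀ x, MeasureTheory.AEStronglyMeasurable (k x) μ
  -- `G` does not depend on x. This uniformity provides both the local majorant for differentiating
  -- under the integral and the exponential bound of the result.
  bound : ∀ b : ℝ, 0 ≤ b → ∃ (b' : ℝ) (G : ℝ → ℝ), 0 ≤ b' ∧ MeasureTheory.Integrable G μ ∧
    ∀ᵐ y ∂μ, ∀ x, ‖k x y‖ * Real.exp (b * |y|) ≤ G y * Real.exp (b' * ∑ i, |x i|)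

/-- The linear map `x ↦ (0, x)`. -/
def consZeroL (n : ℕ) : (Fin n → ℝ) →L[ℝ] (Fin (n + 1) → ℝ) :=
  ContinuousLinearMap.pi (Fin.cons 0 fun i => ContinuousLinearMap.proj i)

theorem hasFDerivAt_cons {n : ℕ} (y : ℝ) (x : Fin n → ℝ) :
    HasFDerivAt (fun x : Fin n → ℝ => (Fin.cons y x : Fin (n + 1) → ℝ)) (consZeroL n) x := by
  refine hasFDerivAt_pi.2 fun i => ?_
  refine Fin.cases ?_ (fun i => ?_) i
  · exact hasFDerivAt_const _ _
  · exact (ContinuousLinearMap.proj i : (Fin n → ℝ) →L[ℝ] ℝ).hasFDerivAt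

theorem consZeroL_single {n : ℕ} (i : Fin n) :
    consZeroL n (Pi.single i 1) = Pi.single i.succ 1 := by
  funext j
  refine Fin.cases ?_ (fun j => ?_) j
  · simp [consZeroL]
  · simp [consZeroL, Pi.single_apply]

theorem continuous_cons_left {n : ℕ} (x : Fin n → ℝ) :
    Continuous fun y : ℝ => (Fin.cons y x : Fin (n + 1) → ℝ) :=
  Continuous.finCons (A := fun _ => ℝ) continuous_id continuous_const

namespace TemperedKernel

open MeasureTheory

variable {n : ℕ} {μ : Measure ℝ} {k : (Fin n → ℝ) → ℝ → ℂ}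
  {q : Fin n → Module.End ℂ (expTempered (n + 1))}

theorem exists_bound (hk : TemperedKernel μ k q) (ψ : expTempered (n + 1)) :
    ∃ (b' : ℝ) (G : ℝ → ℝ), 0 ≤ b' ∧ Integrable G μ ∧
      ∀ᵐ y ∂μ, ∀ x, ‖k x y * ψ.1 (Fin.cons y x)‖ ≤ G y * Real.exp (b' * ∑ i, |x i|) := by
  obtain ⟨a, b, ha, hb, h⟩ := expBounded_of_mem ψ.2
  obtain ⟨b', G, hb', hG, hkG⟩ := hk.bound b hb
  refine ⟨b' + b, fun y => a * G y, by positivity, hG.const_mul a, ?_⟩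
  filter_upwards [hkG] with y hy x
  have h1 := h (Fin.cons y x)
  simp only [Fin.sum_univ_succ, Fin.cons_zero, Fin.cons_succ, mul_add, Real.exp_add] at h1
  rw [norm_mul, add_mul, Real.exp_add]
  have h2 := hy x
  calc ‖k x y‖ * ‖ψ.1 (Fin.cons y x)‖
      ≤ ‖k x y‖ * (a * (Real.exp (b * |y|) * Real.exp (b * ∑ i, |x i|))) := by gcongr
    _ = a * Real.exp (b * ∑ i, |x i|) * (‖k x y‖ * Real.exp (b * |y|)) := by ring
    _ ≤ a * Real.exp (b * ∑ i, |x i|) * (G y * Real.exp (b' * ∑ i, |x i|)) := by gcongr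
    _ = _ := by ring

theorem aestronglyMeasurable (hk : TemperedKernel μ k q) (ψ : expTempered (n + 1))
    (x : Fin n → ℝ) : AEStronglyMeasurable (fun y => k x y * ψ.1 (Fin.cons y x)) μ :=
  (hk.meas x).mul
    ((continuous_of_mem ψ.2).comp (continuous_cons_left x)).aestronglyMeasurable

theorem integrable (hk : TemperedKernel μ k q) (ψ : expTempered (n + 1)) (x : Fin n → ℝ) :
    Integrable (fun y => k x y * ψ.1 (Fin.cons y x)) μ := by
  obtain ⟨b', G, -, hG, h⟩ := hk.exists_bound ψ
  refine (hG.mul_const (Real.exp (b' * ∑ i, |x i|))).mono' (hk.aestronglyMeasurable ψ x) ?_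
  filter_upwards [h] with y hy using hy x

theorem differentiable_integrand (hk : TemperedKernel μ k q) (ψ : expTempered (n + 1)) (y : ℝ) :
    Differentiable ℝ fun x => k x y * ψ.1 (Fin.cons y x) :=
  (hk.diff y).mul fun x => ((differentiable_of_mem ψ.2 _).hasFDerivAt.comp x
    (hasFDerivAt_cons y x)).differentiableAt

theorem partialDeriv_integrand (hk : TemperedKernel μ k q) (ψ : expTempered (n + 1)) (y : ℝ)
    (i : Fin n) (x : Fin n → ℝ) :
    partialDeriv i (fun x => k x y * ψ.1 (Fin.cons y x)) x =
      k x y * (q i ψ + derivE i.succ ψ).1 (Fin.cons y x) := by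
  have h2 := (differentiable_of_mem ψ.2 _).hasFDerivAt.comp x (hasFDerivAt_cons y x)
  have h3 := (hk.diff y x).hasFDerivAt.mul h2
  have h4 := hk.deriv i x y ψ
  have h5 : fderiv ℝ (fun x => k x y * ψ.1 (Fin.cons y x)) x = _ := h3.fderiv
  rw [partialDeriv, h5]
  simp only [add_apply, smul_apply,
    ContinuousLinearMap.comp_apply, consZeroL_single, smul_eq_mul]
  rw [Submodule.coe_add, Pi.add_apply, mul_add, ← h4, add_comm,
    mul_comm (partialDeriv i _ x)]
  rfl

/-- Differentiation under the integral by domination; the integrability of the derivative is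
recorded because it allows evaluating the integrated derivative on basis vectors. -/
theorem hasFDerivAt_integral (hk : TemperedKernel μ k q) (ψ : expTempered (n + 1))
    (x : Fin n → ℝ) :
    HasFDerivAt (fun x => ∫ y, k x y * ψ.1 (Fin.cons y x) ∂μ)
      (∫ y, fderiv ℝ (fun x => k x y * ψ.1 (Fin.cons y x)) x ∂μ) x ∧
    Integrable (fun y => fderiv ℝ (fun x => k x y * ψ.1 (Fin.cons y x)) x) μ := by
  set Ψ : Fin n → expTempered (n + 1) := fun i => q i ψ + derivE i.succ ψ with hΨ
  choose b G hb hG hbound using fun i => hk.exists_bound (Ψ i)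
  have hmeas : AEStronglyMeasurable
      (fun y => fderiv ℝ (fun x => k x y * ψ.1 (Fin.cons y x)) x) μ := by
    simp_rw [fderiv_eq_sum_partialDeriv, hk.partialDeriv_integrand ψ]
    refine Finset.aestronglyMeasurable_fun_sum _ fun i _ => ?_
    exact ((ContinuousLinearMap.smulRightL ℝ (Fin n → ℝ) ℂ
      (ContinuousLinearMap.proj i)).continuous).comp_aestronglyMeasurable
        (hk.aestronglyMeasurable (Ψ i) x)
  -- On the unit ball around x one has |z_j| ≤ |x_j| + 1, so the bounds of the partials of the
  -- integrand become independent of z.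
  have hle : ∀ᵐ y ∂μ, ∀ z ∈ Metric.ball x 1,
      ‖fderiv ℝ (fun x => k x y * ψ.1 (Fin.cons y x)) z‖ ≤
        ∑ i, ‖G i y‖ * Real.exp (b i * ∑ j, (|x j| + 1)) := by
    filter_upwards [ae_all_iff.2 hbound] with y hy z hz
    refine (norm_clm_le_sum_single _).trans (Finset.sum_le_sum fun i _ => ?_)
    change ‖partialDeriv i (fun x => k x y * ψ.1 (Fin.cons y x)) z‖ ≤ _
    rw [hk.partialDeriv_integrand ψ]
    refine (hy i z).trans ?_
    have h1 : ∀ j, |z j| ≤ |x j| + 1 := fun j => by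
      have h2 : |z j - x j| ≤ 1 := by
        rw [Metric.mem_ball, dist_eq_norm] at hz
        exact (norm_le_pi_norm (z - x) j).trans hz.le
      have h3 := abs_sub_abs_le_abs_sub (z j) (x j)
      linarith
    have := hb i
    gcongr
    · exact Real.le_norm_self _
    · exact h1 _
  have hint : Integrable (fun y => ∑ i, ‖G i y‖ * Real.exp (b i * ∑ j, (|x j| + 1))) μ :=
    integrable_finsetSum _ fun i _ => (hG i).norm.mul_const _
  refine ⟨hasFDerivAt_integral_of_dominated_of_fderiv_le (Metric.ball_mem_nhds x one_pos)
    (Filter.Eventually.of_forall fun z => hk.aestronglyMeasurable ψ z) (hk.integrable ψ x) hmeas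
    hle hint (Filter.Eventually.of_forall fun y z _ =>
      (hk.differentiable_integrand ψ y z).hasFDerivAt), ?_⟩
  refine hint.mono' hmeas ?_
  filter_upwards [hle] with y hy using hy x (Metric.mem_ball_self one_pos)

theorem partialDeriv_integral (hk : TemperedKernel μ k q) (ψ : expTempered (n + 1)) (i : Fin n) :
    partialDeriv i (fun x => ∫ y, k x y * ψ.1 (Fin.cons y x) ∂μ) =
      fun x => ∫ y, k x y * (q i ψ + derivE i.succ ψ).1 (Fin.cons y x) ∂μ := by
  funext x
  obtain ⟨h1, h2⟩ := hk.hasFDerivAt_integral ψ x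
  rw [partialDeriv, h1.fderiv, ContinuousLinearMap.integral_apply h2]
  exact integral_congr_ae (Filter.Eventually.of_forall fun y => hk.partialDeriv_integrand ψ y i x)

theorem expBounded_integral (hk : TemperedKernel μ k q) (ψ : expTempered (n + 1)) :
    ExpBounded fun x => ∫ y, k x y * ψ.1 (Fin.cons y x) ∂μ := by
  obtain ⟨b', G, hb', hG, h⟩ := hk.exists_bound ψ
  refine ⟨∫ y, ‖G y‖ ∂μ, b', integral_nonneg fun y => norm_nonneg _, hb', fun x => ?_⟩
  rw [← integral_mul_const]
  refine norm_integral_le_of_norm_le (hG.norm.mul_const _) ?_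
  filter_upwards [h] with y hy
  refine (hy x).trans ?_
  gcongr
  exact Real.le_norm_self _

/-- Differentiating replaces ψ by `q i ψ + derivE i.succ ψ`, again tempered, so the integrals
against a fixed kernel form a closed class. -/
theorem integral_mem (hk : TemperedKernel μ k q) (ψ : expTempered (n + 1)) :
    (fun x => ∫ y, k x y * ψ.1 (Fin.cons y x) ∂μ) ∈ expTempered n := by
  refine mem_expTempered_of_closed
    {f | ∃ ψ : expTempered (n + 1), f = fun x => ∫ y, k x y * ψ.1 (Fin.cons y x) ∂μ}
    ?_ ?_ ?_ ⟨ψ, rfl⟩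
  · rintro _ ⟨ψ, rfl⟩ x
    exact (hk.hasFDerivAt_integral ψ x).1.differentiableAt
  · rintro _ ⟨ψ, rfl⟩
    exact hk.expBounded_integral ψ
  · rintro _ ⟨ψ, rfl⟩ i
    exact ⟨_, hk.partialDeriv_integral ψ i⟩

/-- The operator `ψ ↦ ∫ k(x, y) ψ(y, x) dμ(y)`. -/
def op (hk : TemperedKernel μ k q) : expTempered (n + 1) →ₗ[ℂ] expTempered n where
  toFun ψ := ⟨fun x => ∫ y, k x y * ψ.1 (Fin.cons y x) ∂μ, hk.integral_mem ψ⟩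
  map_add' ψ χ := Subtype.ext <| funext fun x => by
    simp only [Submodule.coe_add, Pi.add_apply, mul_add]
    exact integral_add (hk.integrable ψ x) (hk.integrable χ x)
  map_smul' c ψ := Subtype.ext <| funext fun x => by
    simp only [Submodule.coe_smul, Pi.smul_apply, smul_eq_mul, mul_left_comm _ c,
      RingHom.id_apply]
    exact integral_const_mul _ _

theorem op_apply (hk : TemperedKernel μ k q) (ψ : expTempered (n + 1)) (x : Fin n → ℝ) :
    (hk.op ψ).1 x = ∫ y, k x y * ψ.1 (Fin.cons y x) ∂μ := rfl

theorem derivE_op (hk : TemperedKernel μ k q) (ψ : expTempered (n + 1)) (i : Fin n) :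
    derivE i (hk.op ψ) = hk.op (q i ψ + derivE i.succ ψ) :=
  Subtype.ext (hk.partialDeriv_integral ψ i)

theorem expE_op (hk : TemperedKernel μ k q) (ψ : expTempered (n + 1)) (s : ℝ) (i : Fin n) :
    expE s i (hk.op ψ) = hk.op (expE s i.succ ψ) := by
  apply Subtype.ext
  funext x
  change (Real.exp (s * x i) : ℂ) * (∫ y, k x y * ψ.1 (Fin.cons y x) ∂μ) =
    ∫ y, k x y * ((Real.exp (s * (Fin.cons y x : Fin (n + 1) → ℝ) i.succ) : ℂ) *
      ψ.1 (Fin.cons y x)) ∂μ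
  rw [← integral_const_mul]
  simp only [Fin.cons_succ, mul_left_comm]

end TemperedKernel

/-! ### Permutations and reflections of coordinates -/

/-- The linear map `z ↦ (z_{σ(1)}, …, z_{σ(m)})`. -/
def coordL {n m : ℕ} (σ : Fin m → Fin n) : (Fin n → ℝ) →L[ℝ] (Fin m → ℝ) :=
  ContinuousLinearMap.pi fun i => ContinuousLinearMap.proj (σ i)

theorem coordL_apply {n m : ℕ} (σ : Fin m → Fin n) (z : Fin n → ℝ) (i : Fin m) :
    coordL σ z i = z (σ i) := rfl

/-- By `h` the variable i is substituted in slot j only, so the chain rule has a single term. -/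
theorem derivE_pullE_coordL {n m : ℕ} (σ : Fin m → Fin n) (φ : expTempered m) (i : Fin n)
    (j : Fin m) (h : ∀ l, σ l = i ↔ l = j) :
    derivE i (pullE (coordL σ) φ) = pullE (coordL σ) (derivE j φ) := by
  rw [derivE_pullE]
  congr 1
  rw [Finset.sum_eq_single j]
  · simp [coordL_apply, (h j).2 rfl]
  · intro l _ hl
    simp [coordL_apply, mt (h l).1 hl]
  · simp

theorem derivE_pullE_coordL_eq_zero {n m : ℕ} (σ : Fin m → Fin n) (φ : expTempered m) (i : Fin n)
    (h : ∀ l, σ l ≠ i) : derivE i (pullE (coordL σ) φ) = 0 := by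
  rw [derivE_pullE]
  simp [coordL_apply, h]

theorem expE_pullE_coordL {n m : ℕ} (σ : Fin m → Fin n) (φ : expTempered m) (s : ℝ)
    (j : Fin m) : expE s (σ j) (pullE (coordL σ) φ) = pullE (coordL σ) (expE s j φ) :=
  expE_pullE _ _ _ _ _ _ fun _ => rfl

/-- The linear map which changes the sign of the coordinate `j`. -/
def reflL {n : ℕ} (j : Fin n) : (Fin n → ℝ) →L[ℝ] (Fin n → ℝ) :=
  ContinuousLinearMap.pi fun i => (if i = j then (-1 : ℝ) else 1) • ContinuousLinearMap.proj i

theorem reflL_apply {n : ℕ} (j : Fin n) (x : Fin n → ℝ) :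
    reflL j x = Function.update x j (-x j) := by
  funext i
  by_cases h : i = j
  · subst h; simp [reflL]
  · simp [reflL, h]

/-- The reflection `r_j` as an operator on `𝓔(ℝⁿ)`. -/
def reflE {n : ℕ} (j : Fin n) : Module.End ℂ (expTempered n) := pullE (reflL j)

theorem reflE_coe {n : ℕ} (j : Fin n) (φ : expTempered n) :
    (reflE j φ).1 = reflect j φ.1 := by
  funext x
  exact congrArg φ.1 (reflL_apply j x)

theorem derivE_mul_reflE_self {n : ℕ} (j : Fin n) :
    derivE j * reflE j = -(reflE j * derivE j) := by
  refine LinearMap.ext fun φ => ?_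
  change derivE j (pullE (reflL j) φ) = -pullE (reflL j) (derivE j φ)
  rw [derivE_pullE, ← map_neg]
  congr 1
  rw [Finset.sum_eq_single j]
  · simp only [reflL, ContinuousLinearMap.pi_apply, if_pos]
    simp only [smul_apply, ContinuousLinearMap.proj_apply, Pi.single_eq_same, smul_eq_mul,
      mul_one, Complex.ofReal_neg, Complex.ofReal_one]
    exact neg_one_smul ℂ (derivE j φ)
  · intro l _ hl
    simp [reflL, hl]
  · simp

theorem derivE_commute_reflE {n : ℕ} {i j : Fin n} (h : i ≠ j) :
    Commute (derivE i) (reflE j) := by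
  refine LinearMap.ext fun φ => ?_
  change derivE i (pullE (reflL j) φ) = pullE (reflL j) (derivE i φ)
  rw [derivE_pullE]
  congr 1
  rw [Finset.sum_eq_single i]
  · simp [reflL, h]
  · intro l _ hl
    by_cases hj : l = j <;> simp [reflL, hl, hj]
    exact Or.inl (by simp [← hj, hl])
  · simp

theorem expE_mul_reflE_self {n : ℕ} (s : ℝ) (j : Fin n) :
    expE s j * reflE j = reflE j * expE (-s) j :=
  LinearMap.ext fun φ => expE_pullE _ _ _ _ _ _ fun x => by simp [reflL_apply]

theorem expE_commute_reflE {n : ℕ} (s : ℝ) {i j : Fin n} (h : i ≠ j) :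
    Commute (expE s i) (reflE j) :=
  LinearMap.ext fun φ => expE_pullE _ _ _ _ _ _ fun x => by simp [reflL_apply, h]

/-! ### Commutation relations of derivatives and exponentials -/

theorem expE_mul_expE {n : ℕ} (s t : ℝ) (j : Fin n) :
    (expE s j * expE t j : Module.End ℂ (expTempered n)) = expE (s + t) j := by
  refine LinearMap.ext fun φ => Subtype.ext (funext fun x => ?_)
  change (Real.exp (s * x j) : ℂ) * ((Real.exp (t * x j) : ℂ) * φ.1 x) =
    (Real.exp ((s + t) * x j) : ℂ) * φ.1 x
  rw [add_mul, Real.exp_add]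
  push_cast
  ring

theorem expE_zero {n : ℕ} (j : Fin n) : (expE 0 j : Module.End ℂ (expTempered n)) = 1 := by
  refine LinearMap.ext fun φ => Subtype.ext (funext fun x => ?_)
  change (Real.exp (0 * x j) : ℂ) * φ.1 x = φ.1 x
  simp

theorem expE_mul_expE_neg {n : ℕ} (s : ℝ) (j : Fin n) :
    (expE s j * expE (-s) j : Module.End ℂ (expTempered n)) = 1 := by
  rw [expE_mul_expE, add_neg_cancel, expE_zero]

theorem expE_neg_mul_expE {n : ℕ} (s : ℝ) (j : Fin n) :
    (expE (-s) j * expE s j : Module.End ℂ (expTempered n)) = 1 := by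
  rw [expE_mul_expE, neg_add_cancel, expE_zero]

theorem expE_commute_expE {n : ℕ} (s t : ℝ) (i j : Fin n) :
    Commute (expE s i : Module.End ℂ (expTempered n)) (expE t j) :=
  LinearMap.ext fun φ => Subtype.ext (funext fun x => mul_left_comm _ _ (φ.1 x))

theorem derivE_mul_expE_self {n : ℕ} (s : ℝ) (j : Fin n) :
    derivE j * expE s j = expE s j * (derivE j + algebraMap ℂ _ (s : ℂ)) := by
  refine LinearMap.ext fun φ => Subtype.ext ?_
  refine (partialDeriv_expMul s j j φ.2.1).trans ?_
  rw [if_pos rfl, add_comm]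
  rfl

theorem derivE_commute_expE {n : ℕ} (s : ℝ) {i j : Fin n} (h : i ≠ j) :
    Commute (derivE i) (expE s j) := by
  refine LinearMap.ext fun φ => Subtype.ext ?_
  refine (partialDeriv_expMul s j i φ.2.1).trans ?_
  rw [if_neg h]
  simp
  rfl

theorem derivE_commute_derivE {n : ℕ} (i j : Fin n) :
    Commute (derivE i : Module.End ℂ (expTempered n)) (derivE j) := by
  have key : ∀ (i j : Fin n) (φ : expTempered n) (x : Fin n → ℝ),
      partialDeriv i (partialDeriv j φ.1) x =
        fderiv ℝ (fderiv ℝ φ.1) x (Pi.single i 1) (Pi.single j 1) := by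
    intro i j φ x
    have h1 : Differentiable ℝ (fderiv ℝ φ.1) :=
      (φ.2.1.fderiv_right (m := 1) (by norm_cast)).differentiable (by simp)
    have h2 : HasFDerivAt (partialDeriv j φ.1) _ x :=
      (h1 x).hasFDerivAt.clm_apply
        (hasFDerivAt_const (Pi.single j 1 : Fin n → ℝ) x)
    rw [partialDeriv, h2.fderiv]
    simp
  refine LinearMap.ext fun φ => Subtype.ext (funext fun x => ?_)
  change partialDeriv i (partialDeriv j φ.1) x = partialDeriv j (partialDeriv i φ.1) x
  rw [key, key]
  refine (φ.2.1.contDiffAt.isSymmSndFDerivAt ?_) _ _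
  rw [minSmoothness_of_isRCLikeNormedField]
  exact WithTop.coe_le_coe.2 le_top

/-! ### The operator `𝓡` -/

/-- The tangent to exp at log N lies below exp. This lets the double exponentials in the kernels
beat any e^{N|y|}. -/
theorem mul_le_exp_add {N : ℝ} (hN : 0 < N) (t : ℝ) : N * t ≤ Real.exp t + N * |Real.log N| := by
  have h1 := Real.add_one_le_exp (t - Real.log N)
  rw [Real.exp_sub, Real.exp_log hN, le_div_iff₀ hN] at h1
  have h2 := mul_le_mul_of_nonneg_left (le_abs_self (Real.log N)) hN.le
  nlinarith

theorem integrable_exp_neg_abs : MeasureTheory.Integrable fun y : ℝ => Real.exp (-|y|) := by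
  rw [← MeasureTheory.integrableOn_univ, ← Set.Iic_union_Ioi (a := (0 : ℝ))]
  refine MeasureTheory.IntegrableOn.union ?_ ?_
  · refine (integrableOn_exp_Iic 0).congr_fun (fun y hy => ?_) measurableSet_Iic
    simp only [abs_of_nonpos (Set.mem_Iic.1 hy), neg_neg]
  · refine (exp_neg_integrableOn_Ioi 0 one_pos).congr_fun (fun y hy => ?_) measurableSet_Ioi
    simp only [abs_of_pos (Set.mem_Ioi.1 hy), neg_mul, one_mul]

/-- The kernel of `𝓡_{ja}(v)`. -/
def rKernel {n : ℕ} (j a : Fin n) (v : ℂ) (x : Fin n → ℝ) (y : ℝ) : ℂ :=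
  Complex.exp (Complex.I * v * ((x j - y : ℝ) : ℂ)
      - (Real.exp (x j - y) : ℂ) - (Real.exp (y - x a) : ℂ))

/-- The logarithmic derivatives of the kernel of `𝓡_{ja}(v)`. -/
def rLogDeriv {n : ℕ} (j a : Fin n) (v : ℂ) (i : Fin n) :
    Module.End ℂ (expTempered (n + 1)) :=
  (if i = j then algebraMap ℂ _ (Complex.I * v) - expE 1 j.succ * expE (-1) 0 else 0)
    + if i = a then expE 1 0 * expE (-1) a.succ else 0

/-- Decay comes from e^{−e^{y−x_a}} for y ≥ 0 and from e^{−e^{x_j−y}} for y < 0; the other double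
exponential is at most 1. -/
theorem norm_rKernel_le {n : ℕ} (j a : Fin n) (v : ℂ) {N : ℝ} (hN : 0 < N) (x : Fin n → ℝ)
    (y : ℝ) : ‖rKernel j a v x y‖ ≤ Real.exp (N * |Real.log N| + (|v.im| - N) * |y|
      + (|v.im| + N) * ∑ i, |x i|) := by
  rw [rKernel, Complex.norm_exp]
  refine Real.exp_le_exp.2 ?_
  have hre : (Complex.I * v * ((x j - y : ℝ) : ℂ) - (Real.exp (x j - y) : ℂ)
      - (Real.exp (y - x a) : ℂ)).re = -v.im * (x j - y) - Real.exp (x j - y)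
        - Real.exp (y - x a) := by
    rw [Complex.sub_re, Complex.sub_re, Complex.re_mul_ofReal, Complex.ofReal_re,
      Complex.ofReal_re]
    simp
  rw [hre]
  have hs : ∀ i, |x i| ≤ ∑ i, |x i| := fun i =>
    Finset.single_le_sum (f := fun i => |x i|) (fun i _ => abs_nonneg _) (Finset.mem_univ i)
  have h1 : -v.im * (x j - y) ≤ |v.im| * (∑ i, |x i| + |y|) := by
    refine (le_abs_self _).trans ?_
    rw [abs_mul, abs_neg]
    refine mul_le_mul_of_nonneg_left ?_ (abs_nonneg _)
    exact (abs_sub _ _).trans (add_le_add_left (hs j) _)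
  have h2 : N * |y| - N * ∑ i, |x i| - N * |Real.log N| ≤
      Real.exp (x j - y) + Real.exp (y - x a) := by
    have e1 := Real.exp_pos (x j - y)
    have e2 := Real.exp_pos (y - x a)
    rcases abs_cases y with ⟨h, _⟩ | ⟨h, _⟩
    · have h3 := mul_le_exp_add hN (y - x a)
      have h4 := mul_le_mul_of_nonneg_left ((le_abs_self _).trans (hs a)) hN.le
      rw [h]
      linarith
    · have h3 := mul_le_exp_add hN (x j - y)
      have h4 := mul_le_mul_of_nonneg_left ((neg_le_abs _).trans (hs j)) hN.le
      rw [h]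
      linarith
  linarith

theorem hasFDerivAt_rKernel {n : ℕ} (j a : Fin n) (v : ℂ) (y : ℝ) (x : Fin n → ℝ) :
    HasFDerivAt (fun x => rKernel j a v x y) (rKernel j a v x y •
      ((Complex.I * v - (Real.exp (x j - y) : ℂ)) • (Complex.ofRealCLM.comp
        (ContinuousLinearMap.proj j : (Fin n → ℝ) →L[ℝ] ℝ)) +
      (Real.exp (y - x a) : ℂ) • (Complex.ofRealCLM.comp
        (ContinuousLinearMap.proj a : (Fin n → ℝ) →L[ℝ] ℝ)))) x := by
  have hp : ∀ i : Fin n, HasFDerivAt (fun x : Fin n → ℝ => x i)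
      (ContinuousLinearMap.proj i : (Fin n → ℝ) →L[ℝ] ℝ) x := fun i =>
    (ContinuousLinearMap.proj i : (Fin n → ℝ) →L[ℝ] ℝ).hasFDerivAt
  have hc : ∀ {f : (Fin n → ℝ) → ℝ} {f' : (Fin n → ℝ) →L[ℝ] ℝ}, HasFDerivAt f f' x →
      HasFDerivAt (fun x => (f x : ℂ)) (Complex.ofRealCLM.comp f') x := fun h =>
    Complex.ofRealCLM.hasFDerivAt.comp x h
  have h1 := (hc ((hp j).sub_const y)).const_mul (Complex.I * v)
  have h2 := hc ((hp j).sub_const y).exp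
  have h3 := hc ((hp a).const_sub y).exp
  refine ((h1.sub h2).sub h3).cexp.congr_fderiv ?_
  ext w
  simp [rKernel]
  ring

theorem temperedKernel_rKernel {n : ℕ} (j a : Fin n) (v : ℂ) :
    TemperedKernel MeasureTheory.volume (rKernel j a v) (rLogDeriv j a v) where
  diff y x := (hasFDerivAt_rKernel j a v y x).differentiableAt
  deriv i x y ψ := by
    rw [partialDeriv, (hasFDerivAt_rKernel j a v y x).fderiv]
    have h1 : (expE 1 j.succ (expE (-1) 0 ψ)).1 (Fin.cons y x) =
        (Real.exp (x j - y) : ℂ) * ψ.1 (Fin.cons y x) := by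
      change (Real.exp (1 * x j) : ℂ) * ((Real.exp (-1 * y) : ℂ) * ψ.1 (Fin.cons y x)) = _
      rw [one_mul, neg_one_mul, sub_eq_add_neg, Real.exp_add]
      push_cast
      ring
    have h2 : (expE 1 0 (expE (-1) a.succ ψ)).1 (Fin.cons y x) =
        (Real.exp (y - x a) : ℂ) * ψ.1 (Fin.cons y x) := by
      change (Real.exp (1 * y) : ℂ) * ((Real.exp (-1 * x a) : ℂ) * ψ.1 (Fin.cons y x)) = _
      rw [one_mul, neg_one_mul, sub_eq_add_neg, Real.exp_add]
      push_cast
      ring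
    by_cases hj : i = j <;> by_cases ha : i = a
    · subst hj; subst ha
      simp [rLogDeriv, Module.End.mul_apply, h1, h2, Module.algebraMap_end_apply]
      ring
    · subst hj
      simp [rLogDeriv, Module.End.mul_apply, h1, Module.algebraMap_end_apply, ha, Ne.symm ha]
      ring
    · subst ha
      simp [rLogDeriv, Module.End.mul_apply, h2, hj, Ne.symm hj]
      ring
    · simp [rLogDeriv, hj, ha, Ne.symm hj, Ne.symm ha]
  meas x := by
    refine Continuous.aestronglyMeasurable ?_
    unfold rKernel
    fun_prop
  bound b hb := by
    -- This N outweighs the growth |Im v| of the kernel and b of the test function, and leaves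
    -- e^{−|y|}.
    have hN : 0 < |v.im| + b + 1 := by positivity
    set N := |v.im| + b + 1 with hNdef
    refine ⟨|v.im| + N, fun y => Real.exp (N * |Real.log N|) * Real.exp (-|y|), by positivity,
      integrable_exp_neg_abs.const_mul _, Filter.Eventually.of_forall fun y x => ?_⟩
    refine (mul_le_mul_of_nonneg_right (norm_rKernel_le j a v hN x y) (Real.exp_pos _).le).trans ?_
    simp only [← Real.exp_add]
    refine Real.exp_le_exp.2 (le_of_eq ?_)
    rw [hNdef]
    ring

/-- The substitution in the integrand of `𝓡_{ja}`. -/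
def rIndex {n : ℕ} (j a : Fin n) (i : Fin n) : Fin (n + 1) :=
  if i = a then j.succ else if i = j then 0 else i.succ

/-- The operator `𝓡_{ja}(v)` on `𝓔(ℝⁿ)`. -/
def rE {n : ℕ} (j a : Fin n) (v : ℂ) : Module.End ℂ (expTempered n) :=
  (temperedKernel_rKernel j a v).op ∘ₗ pullE (coordL (rIndex j a))

theorem rIntegrand_eq {n : ℕ} (j a : Fin n) (v : ℂ) (φ : expTempered n) (x : Fin n → ℝ) :
    rIntegrand j a v φ.1 x =
      fun y => rKernel j a v x y * (pullE (coordL (rIndex j a)) φ).1 (Fin.cons y x) := by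
  funext y
  change _ * _ = _ * φ.1 _
  congr 1
  refine congrArg φ.1 (funext fun i => ?_)
  rw [coordL_apply, rIndex]
  by_cases ha : i = a
  · subst ha; simp
  · by_cases hj : i = j
    · subst hj; simp [ha]
    · simp [ha, hj]

theorem integrable_rIntegrand {n : ℕ} (j a : Fin n) (v : ℂ) (φ : expTempered n)
    (x : Fin n → ℝ) : MeasureTheory.Integrable (rIntegrand j a v φ.1 x) := by
  rw [rIntegrand_eq]
  exact (temperedKernel_rKernel j a v).integrable _ x

theorem rE_coe {n : ℕ} (j a : Fin n) (v : ℂ) (φ : expTempered n) :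
    (rE j a v φ).1 = rOp j a v φ.1 := by
  funext x
  rw [rOp, rIntegrand_eq]
  rfl

theorem hasDerivAt_cons {n : ℕ} (ψ : expTempered (n + 1)) (x : Fin n → ℝ) (y : ℝ) :
    HasDerivAt (fun y => ψ.1 (Fin.cons y x)) ((derivE 0 ψ).1 (Fin.cons y x)) y := by
  have h1 : HasDerivAt (fun y : ℝ => (Fin.cons y x : Fin (n + 1) → ℝ)) (Pi.single 0 1) y := by
    refine hasDerivAt_pi.2 fun i => ?_
    refine Fin.cases ?_ (fun i => ?_) i
    · simpa using hasDerivAt_id' y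
    · simpa using hasDerivAt_const y (x i)
  exact (differentiable_of_mem ψ.2 _).hasFDerivAt.comp_hasDerivAt y h1

/-! ### Relations for the operator `𝓡` -/

section
variable {n : ℕ} {j a : Fin n}

theorem rIndex_self_left (h : j ≠ a) : rIndex j a j = 0 := by simp [rIndex, h]

theorem rIndex_self_right : rIndex j a a = j.succ := by simp [rIndex]

theorem rIndex_eq_zero_iff (h : j ≠ a) (l : Fin n) : rIndex j a l = 0 ↔ l = j := by
  unfold rIndex
  split_ifs with h1 h2
  · simp [h1, h.symm]
  · simp [h2]
  · simp [h2]

theorem rIndex_eq_succ_left_iff (l : Fin n) : rIndex j a l = j.succ ↔ l = a := by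
  unfold rIndex
  split_ifs with h1 h2
  · simp [h1]
  · simp [h1, (Fin.succ_ne_zero j).symm]
  · simp [h1, h2]

theorem rIndex_ne_succ_right (h : j ≠ a) (l : Fin n) : rIndex j a l ≠ a.succ := by
  unfold rIndex
  split_ifs with h1 h2
  · simp [h]
  · exact (Fin.succ_ne_zero a).symm
  · simp [h1]

theorem rIndex_eq_succ_iff {i : Fin n} (hj : i ≠ j) (ha : i ≠ a) (l : Fin n) :
    rIndex j a l = i.succ ↔ l = i := by
  unfold rIndex
  split_ifs with h1 h2
  · simp [h1, ha.symm, hj.symm]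
  · simp [h2, (Fin.succ_ne_zero i).symm, hj.symm]
  · simp

theorem derivE_commute_rE {i : Fin n} (hj : i ≠ j) (ha : i ≠ a) (v : ℂ) :
    Commute (derivE i) (rE j a v) := by
  refine LinearMap.ext fun φ => ?_
  change derivE i ((temperedKernel_rKernel j a v).op (pullE (coordL (rIndex j a)) φ)) =
    (temperedKernel_rKernel j a v).op (pullE (coordL (rIndex j a)) (derivE i φ))
  rw [TemperedKernel.derivE_op, derivE_pullE_coordL _ _ _ i (rIndex_eq_succ_iff hj ha)]
  simp [rLogDeriv, hj, ha]

theorem expE_commute_rE {i : Fin n} (hj : i ≠ j) (ha : i ≠ a) (s : ℝ) (v : ℂ) :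
    Commute (expE s i) (rE j a v) := by
  refine LinearMap.ext fun φ => ?_
  change expE s i ((temperedKernel_rKernel j a v).op (pullE (coordL (rIndex j a)) φ)) =
    (temperedKernel_rKernel j a v).op (pullE (coordL (rIndex j a)) (expE s i φ))
  rw [TemperedKernel.expE_op, ← expE_pullE_coordL, (rIndex_eq_succ_iff hj ha i).2 rfl]

/-- The slot a of φ is filled with x_j, so e^{s x_j} passes under the integral and acts on φ as e^{s
x_a}. -/
theorem expE_mul_rE (s : ℝ) (v : ℂ) : expE s j * rE j a v = rE j a v * expE s a := by
  refine LinearMap.ext fun φ => ?_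
  change expE s j ((temperedKernel_rKernel j a v).op (pullE (coordL (rIndex j a)) φ)) =
    (temperedKernel_rKernel j a v).op (pullE (coordL (rIndex j a)) (expE s a φ))
  rw [TemperedKernel.expE_op, ← expE_pullE_coordL, rIndex_self_right]

/-- Lowering v by i multiplies the kernel by e^{x_j−y}: e^{x_j} acts after the integration, and
e^{−y} acts on the slot j of φ. -/
theorem rE_sub_I (h : j ≠ a) (v : ℂ) :
    rE j a (v - Complex.I) = expE 1 j * rE j a v * expE (-1) j := by
  refine LinearMap.ext fun φ => ?_
  change (temperedKernel_rKernel j a (v - Complex.I)).op (pullE (coordL (rIndex j a)) φ) =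
    expE 1 j ((temperedKernel_rKernel j a v).op (pullE (coordL (rIndex j a)) (expE (-1) j φ)))
  rw [TemperedKernel.expE_op, ← expE_pullE_coordL, rIndex_self_left h]
  refine Subtype.ext (funext fun x => ?_)
  rw [TemperedKernel.op_apply, TemperedKernel.op_apply]
  congr 1
  funext y
  change rKernel j a (v - Complex.I) x y * _ = rKernel j a v x y *
    ((Real.exp (1 * x j) : ℂ) * ((Real.exp (-1 * y) : ℂ) * _))
  have h1 : rKernel j a (v - Complex.I) x y =
      rKernel j a v x y * ((Real.exp (1 * x j) : ℂ) * (Real.exp (-1 * y) : ℂ)) := by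
    simp only [rKernel, Complex.ofReal_exp, ← Complex.exp_add]
    congr 1
    push_cast
    linear_combination ((y : ℂ) - x j) * Complex.I_sq
  rw [h1]
  ring

/-- Integration by parts over ℝ. The kernel depends only on x_j − y and y − x_a, so ∂_y acts on it
as −(∂_{x_j} + ∂_{x_a}). There are no boundary terms, as the product and its derivative are
integrable. -/
theorem op_derivE_zero (h : j ≠ a) (v : ℂ) (ψ : expTempered (n + 1)) :
    (temperedKernel_rKernel j a v).op (derivE 0 ψ) =
      (temperedKernel_rKernel j a v).op (rLogDeriv j a v j ψ + rLogDeriv j a v a ψ) := by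
  set hk := temperedKernel_rKernel j a v
  rw [← sub_eq_zero, ← map_sub]
  refine Subtype.ext (funext fun x => ?_)
  rw [TemperedKernel.op_apply]
  refine MeasureTheory.integral_eq_zero_of_hasDerivAt_of_integrable
    (f := fun y => rKernel j a v x y * ψ.1 (Fin.cons y x)) (fun y => ?_)
    (hk.integrable _ x) (hk.integrable _ x)
  have hc : ∀ {f : ℝ → ℝ} {f' : ℝ}, HasDerivAt f f' y →
      HasDerivAt (fun y => (f y : ℂ)) (f' : ℂ) y := fun h => h.ofReal_comp
  have h1 := (hc ((hasDerivAt_id y).const_sub (x j))).const_mul (Complex.I * v)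
  have h2 := hc ((hasDerivAt_id y).const_sub (x j)).exp
  have h3 := hc ((hasDerivAt_id y).sub_const (x a)).exp
  have h4 := (((h1.sub h2).sub h3).cexp).mul (hasDerivAt_cons ψ x y)
  refine h4.congr_deriv ?_
  have e1 : (rLogDeriv j a v j ψ).1 (Fin.cons y x) =
      (Complex.I * v - (Real.exp (x j - y) : ℂ)) * ψ.1 (Fin.cons y x) := by
    simp only [rLogDeriv, if_pos, if_neg h, add_zero, LinearMap.sub_apply]
    change Complex.I * v * ψ.1 (Fin.cons y x) -
      (Real.exp (1 * x j) : ℂ) * ((Real.exp (-1 * y) : ℂ) * ψ.1 (Fin.cons y x)) = _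
    rw [one_mul, neg_one_mul, sub_eq_add_neg (x j), Real.exp_add]
    push_cast
    ring
  have e2 : (rLogDeriv j a v a ψ).1 (Fin.cons y x) =
      (Real.exp (y - x a) : ℂ) * ψ.1 (Fin.cons y x) := by
    simp only [rLogDeriv, if_pos, if_neg h.symm, zero_add]
    change (Real.exp (1 * y) : ℂ) * ((Real.exp (-1 * x a) : ℂ) * _) = _
    rw [one_mul, neg_one_mul, sub_eq_add_neg y, Real.exp_add]
    push_cast
    ring
  simp only [Submodule.coe_sub, Submodule.coe_add, Pi.sub_apply, Pi.add_apply, e1, e2, rKernel,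
    id_eq]
  push_cast
  ring

theorem derivE_right_mul_rE_aux (h : j ≠ a) (v : ℂ) (φ : expTempered n) :
    derivE a (rE j a v φ) = (temperedKernel_rKernel j a v).op
      (rLogDeriv j a v a (pullE (coordL (rIndex j a)) φ)) := by
  change derivE a ((temperedKernel_rKernel j a v).op _) = _
  rw [TemperedKernel.derivE_op, derivE_pullE_coordL_eq_zero _ _ _ (rIndex_ne_succ_right h),
    add_zero]

/-- The logarithmic derivative in x_j is iv − e^{x_j−y}, and e^{x_j−y} is the kernel ratio between
v−i and v. -/
theorem op_rLogDeriv_left (h : j ≠ a) (v : ℂ) (φ : expTempered n) :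
    (temperedKernel_rKernel j a v).op
      (rLogDeriv j a v j (pullE (coordL (rIndex j a)) φ)) =
    (Complex.I * v) • rE j a v φ - rE j a (v - Complex.I) φ := by
  rw [rE_sub_I h]
  simp only [rLogDeriv, if_pos, if_neg h, add_zero, LinearMap.sub_apply, map_sub,
    Module.algebraMap_end_apply, map_smul, Module.End.mul_apply]
  rw [← TemperedKernel.expE_op, ← rIndex_self_left h, expE_pullE_coordL]
  rfl

/-- The variable x_j occurs twice: in the kernel, and in the slot a of φ, where it produces the term
with ∂_a. -/
theorem derivE_left_mul_rE (h : j ≠ a) (v : ℂ) :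
    derivE j * rE j a v =
      rE j a v * derivE a + (Complex.I * v) • rE j a v - rE j a (v - Complex.I) := by
  refine LinearMap.ext fun φ => ?_
  change derivE j ((temperedKernel_rKernel j a v).op _) = _
  rw [TemperedKernel.derivE_op, derivE_pullE_coordL _ _ _ a rIndex_eq_succ_left_iff, map_add,
    op_rLogDeriv_left h]
  simp only [LinearMap.sub_apply, LinearMap.add_apply, LinearMap.smul_apply, Module.End.mul_apply]
  rw [add_comm, ← add_sub_assoc]
  rfl

/-- Only e^{−e^{y−x_a}} involves x_a. Its derivative brings down e^{−x_a}e^y, and e^y is e^{x_j}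
acting on φ. -/
theorem derivE_right_mul_rE (h : j ≠ a) (v : ℂ) :
    derivE a * rE j a v = expE (-1) a * rE j a v * expE 1 j := by
  refine LinearMap.ext fun φ => ?_
  refine (derivE_right_mul_rE_aux h v φ).trans ?_
  change _ = expE (-1) a ((temperedKernel_rKernel j a v).op
    (pullE (coordL (rIndex j a)) (expE 1 j φ)))
  rw [TemperedKernel.expE_op, ← expE_pullE_coordL, rIndex_self_left h]
  simp only [rLogDeriv, if_pos, if_neg h.symm, zero_add]
  rw [(expE_commute_expE _ _ _ _).eq]
  rfl

theorem rE_mul_derivE_left (h : j ≠ a) (v : ℂ) :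
    rE j a v * derivE j =
      (Complex.I * v) • rE j a v - rE j a (v - Complex.I) + derivE a * rE j a v := by
  refine LinearMap.ext fun φ => ?_
  change (temperedKernel_rKernel j a v).op (pullE (coordL (rIndex j a)) (derivE j φ)) = _
  rw [← derivE_pullE_coordL _ _ _ j (rIndex_eq_zero_iff h), op_derivE_zero h, map_add,
    op_rLogDeriv_left h, ← derivE_right_mul_rE_aux h]
  rfl

end

/-! ### The reflection operator -/

/-- The kernel of the reflection operator `𝓚_a(v)`. -/
def kKernel {n : ℕ} (α β : ℝ) (a : Fin n) (v : ℂ) (x : Fin n → ℝ) (y : ℝ) : ℂ :=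
  Complex.exp (-2 * Complex.I * v * (y : ℂ) - (Real.exp (y - x a) : ℂ))
    * ((1 + β * Real.exp (-y) : ℝ) : ℂ) ^ (-Complex.I * v - (gPar α β : ℂ))
    * ((1 - β * Real.exp (-y) : ℝ) : ℂ) ^ (-Complex.I * v + (gPar α β : ℂ) - 1)

/-- The logarithmic derivatives of the kernel of `𝓚_a(v)`. -/
def kLogDeriv {n : ℕ} (a i : Fin n) : Module.End ℂ (expTempered (n + 1)) :=
  if i = a then expE 1 0 * expE (-1) a.succ else 0

/-- The substitution in the integrand of `𝓚_a`. -/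
def kL {n : ℕ} (a : Fin n) : (Fin (n + 1) → ℝ) →L[ℝ] (Fin n → ℝ) :=
  ContinuousLinearMap.pi fun i =>
    if i = a then -ContinuousLinearMap.proj 0 else ContinuousLinearMap.proj i.succ

theorem kL_self {n : ℕ} (a : Fin n) (z : Fin (n + 1) → ℝ) : kL a z a = -z 0 := by simp [kL]

theorem kL_of_ne {n : ℕ} {i a : Fin n} (h : i ≠ a) (z : Fin (n + 1) → ℝ) :
    kL a z i = z i.succ := by simp [kL, h]

theorem one_sub_mul_exp_neg_pos {β y : ℝ} (hβ : 0 < β) (hy : Real.log β < y) :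
    0 < 1 - β * Real.exp (-y) := by
  have h1 : β < Real.exp y := (Real.log_lt_iff_lt_exp hβ).1 hy
  rw [Real.exp_neg, ← div_eq_mul_inv, sub_pos, div_lt_one (Real.exp_pos y)]
  exact h1

/-- Up to the factor p this is the derivative of (1−βe^{−y})^p, which increases from 0 to 1 on the
half-line. -/
theorem integrableOn_rpow_mul_exp_neg {β p : ℝ} (hβ : 0 < β) (hp : 0 < p) :
    MeasureTheory.IntegrableOn
      (fun y => (1 - β * Real.exp (-y)) ^ (p - 1) * (β * Real.exp (-y)))
      (Set.Ioi (Real.log β)) := by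
  have hd : ∀ y, HasDerivAt (fun y => 1 - β * Real.exp (-y)) (β * Real.exp (-y)) y := fun y => by
    have h := ((hasDerivAt_neg y).exp.const_mul β).const_sub 1
    simpa using h
  have h0 : MeasureTheory.IntegrableOn
      (fun y => β * Real.exp (-y) * p * (1 - β * Real.exp (-y)) ^ (p - 1))
      (Set.Ioi (Real.log β)) := by
    refine MeasureTheory.integrableOn_Ioi_deriv_of_nonneg
      (g := fun y => (1 - β * Real.exp (-y)) ^ p) (l := 1) ?_ ?_ ?_ ?_
    · refine ContinuousAt.continuousWithinAt ?_
      exact ContinuousAt.rpow_const (hd _).continuousAt (Or.inr hp.le)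
    · intro y hy
      exact (hd y).rpow_const (Or.inl (one_sub_mul_exp_neg_pos hβ hy).ne')
    · intro y hy
      have := one_sub_mul_exp_neg_pos hβ hy
      positivity
    · have h1 : Filter.Tendsto (fun y : ℝ => 1 - β * Real.exp (-y)) Filter.atTop
          (nhds (1 - β * 0)) :=
        (Real.tendsto_exp_neg_atTop_nhds_zero.const_mul β).const_sub 1
      have h2 := h1.rpow_const (p := p) (Or.inr hp.le)
      simpa using h2
  refine MeasureTheory.IntegrableOn.congr_fun
    (f := fun y => p⁻¹ * (β * Real.exp (-y) * p * (1 - β * Real.exp (-y)) ^ (p - 1)))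
    (h0.const_mul p⁻¹) (fun y _ => ?_) measurableSet_Ioi
  field_simp

theorem norm_kKernel {n : ℕ} {α β : ℝ} (hβ : 0 < β) (a : Fin n) (v : ℂ) (x : Fin n → ℝ) {y : ℝ}
    (hy : Real.log β < y) : ‖kKernel α β a v x y‖ =
      Real.exp (2 * v.im * y - Real.exp (y - x a)) *
        (1 + β * Real.exp (-y)) ^ (v.im - gPar α β) *
        (1 - β * Real.exp (-y)) ^ (v.im + gPar α β - 1) := by
  have h1 : 0 < 1 + β * Real.exp (-y) := by positivity
  rw [kKernel, norm_mul, norm_mul, Complex.norm_exp, Complex.norm_cpow_eq_rpow_re_of_pos h1,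
    Complex.norm_cpow_eq_rpow_re_of_pos (one_sub_mul_exp_neg_pos hβ hy)]
  have e1 : (-2 * Complex.I * v * (y : ℂ) - (Real.exp (y - x a) : ℂ)).re =
      2 * v.im * y - Real.exp (y - x a) := by
    rw [Complex.sub_re, Complex.re_mul_ofReal, Complex.ofReal_re]
    simp
  have e2 : (-Complex.I * v - (gPar α β : ℂ)).re = v.im - gPar α β := by simp
  have e3 : (-Complex.I * v + (gPar α β : ℂ) - 1).re = v.im + gPar α β - 1 := by simp
  rw [e1, e2, e3]

/-- Only the endpoint singularity at y = log β has to be kept: 1+βe^{−y} stays between 1 and 2, and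
the double exponential absorbs all growth at infinity. -/
theorem exists_kKernel_bound {n : ℕ} {α β : ℝ} (hβ : 0 < β) (a : Fin n) (v : ℂ) {b : ℝ}
    (hb : 0 ≤ b) : ∃ N C : ℝ, 0 ≤ N ∧ ∀ y, Real.log β < y → ∀ x : Fin n → ℝ,
      ‖kKernel α β a v x y‖ * Real.exp (b * |y|) ≤
        C * ((1 - β * Real.exp (-y)) ^ (v.im + gPar α β - 1) * (β * Real.exp (-y))) *
          Real.exp (N * ∑ i, |x i|) := by
  -- The extra 1 yields the factor e^{−y} of the integrable majorant. In `c`, the multiple of |log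
  -- β| covers negative y, where y > log β forces |y| ≤ |log β|.
  set N := 2 * |v.im| + b + 1 with hNdef
  have hN : 0 < N := by positivity
  set c := (2 * |v.im| + 1 + N + b) * |Real.log β| + N * |Real.log N| with hc
  set r := v.im - gPar α β with hr
  refine ⟨N, β⁻¹ * 2 ^ |r| * Real.exp c, hN.le, fun y hy x => ?_⟩
  rw [norm_kKernel hβ a v x hy]
  have h1 := one_sub_mul_exp_neg_pos hβ hy
  have h2 : (1 + β * Real.exp (-y)) ^ r ≤ 2 ^ |r| := by
    have h3 : 1 ≤ 1 + β * Real.exp (-y) := by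
      have : 0 < β * Real.exp (-y) := by positivity
      linarith
    calc (1 + β * Real.exp (-y)) ^ r ≤ (1 + β * Real.exp (-y)) ^ |r| :=
          Real.rpow_le_rpow_of_exponent_le h3 (le_abs_self r)
      _ ≤ 2 ^ |r| := Real.rpow_le_rpow (by linarith) (by linarith) (abs_nonneg r)
  have hxa : |x a| ≤ ∑ i, |x i| :=
    Finset.single_le_sum (f := fun i => |x i|) (fun i _ => abs_nonneg _) (Finset.mem_univ a)
  have h4 : 2 * v.im * y - Real.exp (y - x a) + b * |y| ≤ c - y + N * ∑ i, |x i| := by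
    have h5 := mul_le_exp_add hN (y - x a)
    have h6 := mul_le_mul_of_nonneg_left ((le_abs_self _).trans hxa) hN.le
    have h7 : v.im * y ≤ |v.im| * |y| := (le_abs_self _).trans (abs_mul _ _).le
    have h8 : 2 * |v.im| * |y| + b * |y| + y - N * y ≤
        (2 * |v.im| + 1 + N + b) * |Real.log β| := by
      have h9 := abs_nonneg (Real.log β)
      have h10 := abs_nonneg v.im
      rcases abs_cases y with ⟨h, hy0⟩ | ⟨h, hy0⟩
      · rw [h]
        have : 2 * |v.im| * y + b * y + y - N * y = 0 := by rw [hNdef]; ring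
        rw [this]
        positivity
      · have h11 : |y| ≤ |Real.log β| := by
          rw [h]
          exact (neg_le_neg hy.le).trans (neg_le_abs _)
        have h12 := mul_le_mul_of_nonneg_left h11
          (show 0 ≤ 2 * |v.im| + 1 + N + b by positivity)
        rw [h] at h12 ⊢
        linarith
    linarith
  calc Real.exp (2 * v.im * y - Real.exp (y - x a)) * (1 + β * Real.exp (-y)) ^ r *
        (1 - β * Real.exp (-y)) ^ (v.im + gPar α β - 1) * Real.exp (b * |y|)
      = Real.exp (2 * v.im * y - Real.exp (y - x a) + b * |y|) * (1 + β * Real.exp (-y)) ^ r *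
        (1 - β * Real.exp (-y)) ^ (v.im + gPar α β - 1) := by rw [Real.exp_add]; ring
    _ ≤ Real.exp (c - y + N * ∑ i, |x i|) * 2 ^ |r| *
        (1 - β * Real.exp (-y)) ^ (v.im + gPar α β - 1) := by gcongr
    _ = _ := by
      rw [sub_eq_add_neg, Real.exp_add, Real.exp_add]
      field_simp

theorem hasFDerivAt_kKernel {n : ℕ} (α β : ℝ) (a : Fin n) (v : ℂ) (y : ℝ) (x : Fin n → ℝ) :
    HasFDerivAt (fun x => kKernel α β a v x y) (kKernel α β a v x y •
      ((Real.exp (y - x a) : ℂ) • (Complex.ofRealCLM.comp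
        (ContinuousLinearMap.proj a : (Fin n → ℝ) →L[ℝ] ℝ)))) x := by
  have hp : HasFDerivAt (fun x : Fin n → ℝ => x a)
      (ContinuousLinearMap.proj a : (Fin n → ℝ) →L[ℝ] ℝ) x :=
    (ContinuousLinearMap.proj a : (Fin n → ℝ) →L[ℝ] ℝ).hasFDerivAt
  have h3 : HasFDerivAt (fun x : Fin n → ℝ => (Real.exp (y - x a) : ℂ)) _ x :=
    Complex.ofRealCLM.hasFDerivAt.comp x (hp.const_sub y).exp
  refine ((((h3.const_sub (-2 * Complex.I * v * (y : ℂ))).cexp).mul_const _).mul_const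
    _).congr_fderiv ?_
  ext w
  simp [kKernel]
  ring

theorem temperedKernel_kKernel {n : ℕ} {α β : ℝ} (hβ : 0 < β) (a : Fin n) {v : ℂ}
    (hv : 0 < v.im + gPar α β) :
    TemperedKernel (MeasureTheory.volume.restrict (Set.Ioi (Real.log β))) (kKernel α β a v)
      (kLogDeriv a) where
  diff y x := (hasFDerivAt_kKernel α β a v y x).differentiableAt
  deriv i x y ψ := by
    rw [partialDeriv, (hasFDerivAt_kKernel α β a v y x).fderiv]
    have h2 : (expE 1 0 (expE (-1) a.succ ψ)).1 (Fin.cons y x) =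
        (Real.exp (y - x a) : ℂ) * ψ.1 (Fin.cons y x) := by
      change (Real.exp (1 * y) : ℂ) * ((Real.exp (-1 * x a) : ℂ) * ψ.1 (Fin.cons y x)) = _
      rw [one_mul, neg_one_mul, sub_eq_add_neg, Real.exp_add]
      push_cast
      ring
    by_cases ha : i = a
    · subst ha
      simp [kLogDeriv, Module.End.mul_apply, h2]
      ring
    · simp [kLogDeriv, ha, Ne.symm ha]
  meas x := by
    refine Measurable.aestronglyMeasurable ?_
    unfold kKernel
    fun_prop
  bound b hb := by
    obtain ⟨N, C, hN, h⟩ := exists_kKernel_bound (α := α) hβ a v hb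
    refine ⟨N, _, hN, (integrableOn_rpow_mul_exp_neg hβ hv).const_mul C, ?_⟩
    exact (MeasureTheory.ae_restrict_iff' measurableSet_Ioi).2
      (Filter.Eventually.of_forall fun y hy x => h y hy x)

/-- The reflection operator without the normalising factor, on `𝓔(ℝⁿ)`. -/
def kappaE {n : ℕ} {α β : ℝ} (hβ : 0 < β) (a : Fin n) {v : ℂ} (hv : 0 < v.im + gPar α β) :
    Module.End ℂ (expTempered n) :=
  (temperedKernel_kKernel hβ a hv).op ∘ₗ pullE (kL a)

/-- The reflection operator `𝓚_a(v)` on `𝓔(ℝⁿ)`. -/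
def kE {n : ℕ} {α β : ℝ} (hβ : 0 < β) (a : Fin n) {v : ℂ} (hv : 0 < v.im + gPar α β) :
    Module.End ℂ (expTempered n) :=
  (((2 * β : ℝ) : ℂ) ^ (Complex.I * v) / Complex.Gamma ((gPar α β : ℂ) - Complex.I * v)) •
    kappaE hβ a hv

theorem kIntegrand_eq {n : ℕ} (α β : ℝ) (a : Fin n) (v : ℂ) (φ : expTempered n) (x : Fin n → ℝ) :
    kIntegrand α β a v φ.1 x =
      fun y => kKernel α β a v x y * (pullE (kL a) φ).1 (Fin.cons y x) := by
  funext y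
  change _ * _ = _ * φ.1 _
  congr 1
  refine congrArg φ.1 (funext fun i => ?_)
  by_cases ha : i = a
  · subst ha; simp [kL_self]
  · simp [kL_of_ne ha, ha]

theorem integrableOn_kIntegrand {n : ℕ} {α β : ℝ} (hβ : 0 < β) (a : Fin n) {v : ℂ}
    (hv : 0 < v.im + gPar α β) (φ : expTempered n) (x : Fin n → ℝ) :
    MeasureTheory.IntegrableOn (kIntegrand α β a v φ.1 x) (Set.Ioi (Real.log β)) := by
  rw [kIntegrand_eq]
  exact (temperedKernel_kKernel hβ a hv).integrable _ x

theorem kE_coe {n : ℕ} {α β : ℝ} (hβ : 0 < β) (a : Fin n) {v : ℂ} (hv : 0 < v.im + gPar α β)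
    (φ : expTempered n) : (kE hβ a hv φ).1 = kOp α β a v φ.1 := by
  funext x
  rw [kOp, kIntegrand_eq]
  rfl

/-! ### Relations for the reflection operator -/

theorem derivE_succ_pullE_kL {n : ℕ} {i a : Fin n} (h : i ≠ a) (φ : expTempered n) :
    derivE i.succ (pullE (kL a) φ) = pullE (kL a) (derivE i φ) := by
  rw [derivE_pullE]
  congr 1
  rw [Finset.sum_eq_single i]
  · simp [kL_of_ne h]
  · intro l _ hl
    by_cases hla : l = a
    · subst hla; simp [kL_self, (Fin.succ_ne_zero i).symm]
    · simp [kL_of_ne hla, hl]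
  · simp

theorem derivE_succ_self_pullE_kL {n : ℕ} (a : Fin n) (φ : expTempered n) :
    derivE a.succ (pullE (kL a) φ) = 0 := by
  rw [derivE_pullE, Finset.sum_eq_zero, map_zero]
  intro l _
  by_cases hla : l = a
  · subst hla; simp [kL_self, (Fin.succ_ne_zero l).symm]
  · simp [kL_of_ne hla, hla]

theorem derivE_zero_pullE_kL {n : ℕ} (a : Fin n) (φ : expTempered n) :
    derivE 0 (pullE (kL a) φ) = -pullE (kL a) (derivE a φ) := by
  rw [derivE_pullE, ← map_neg]
  congr 1
  rw [Finset.sum_eq_single a]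
  · simp only [kL_self, Pi.single_eq_same, Complex.ofReal_neg, Complex.ofReal_one]
    exact neg_one_smul ℂ (derivE a φ)
  · intro l _ hl
    simp [kL_of_ne hl]
  · simp

theorem expE_succ_pullE_kL {n : ℕ} {i a : Fin n} (h : i ≠ a) (s : ℝ) (φ : expTempered n) :
    expE s i.succ (pullE (kL a) φ) = pullE (kL a) (expE s i φ) :=
  expE_pullE _ _ _ _ _ _ fun z => by rw [kL_of_ne h]

theorem expE_zero_pullE_kL {n : ℕ} (s : ℝ) (a : Fin n) (φ : expTempered n) :
    expE s 0 (pullE (kL a) φ) = pullE (kL a) (expE (-s) a φ) :=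
  expE_pullE _ _ _ _ _ _ fun z => by rw [kL_self]; ring

section
variable {n : ℕ} {α β : ℝ} (hβ : 0 < β) {a : Fin n} {v : ℂ} (hv : 0 < v.im + gPar α β)

theorem derivE_commute_kappaE {i : Fin n} (h : i ≠ a) :
    Commute (derivE i) (kappaE hβ a hv) := by
  refine LinearMap.ext fun φ => ?_
  change derivE i ((temperedKernel_kKernel hβ a hv).op (pullE (kL a) φ)) =
    (temperedKernel_kKernel hβ a hv).op (pullE (kL a) (derivE i φ))
  rw [TemperedKernel.derivE_op, derivE_succ_pullE_kL h]
  simp [kLogDeriv, h]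

theorem expE_commute_kappaE {i : Fin n} (h : i ≠ a) (s : ℝ) :
    Commute (expE s i) (kappaE hβ a hv) := by
  refine LinearMap.ext fun φ => ?_
  change expE s i ((temperedKernel_kKernel hβ a hv).op (pullE (kL a) φ)) =
    (temperedKernel_kKernel hβ a hv).op (pullE (kL a) (expE s i φ))
  rw [TemperedKernel.expE_op, expE_succ_pullE_kL h]

theorem derivE_commute_kE {i : Fin n} (h : i ≠ a) : Commute (derivE i) (kE hβ a hv) :=
  (derivE_commute_kappaE hβ hv h).smul_right _

theorem expE_commute_kE {i : Fin n} (h : i ≠ a) (s : ℝ) : Commute (expE s i) (kE hβ a hv) :=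
  (expE_commute_kappaE hβ hv h s).smul_right _

theorem derivE_kappaE_apply (φ : expTempered n) :
    derivE a (kappaE hβ a hv φ) =
      (temperedKernel_kKernel hβ a hv).op (kLogDeriv a a (pullE (kL a) φ)) := by
  change derivE a ((temperedKernel_kKernel hβ a hv).op _) = _
  rw [TemperedKernel.derivE_op, derivE_succ_self_pullE_kL, add_zero]

/-- The factor e^y brought down from e^{−e^{y−x_a}} acts on φ as e^{−x_a}, because φ is evaluated at
−y. -/
theorem derivE_mul_kappaE :
    derivE a * kappaE hβ a hv = expE (-1) a * kappaE hβ a hv * expE (-1) a := by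
  refine LinearMap.ext fun φ => ?_
  refine (derivE_kappaE_apply hβ hv φ).trans ?_
  change _ = expE (-1) a ((temperedKernel_kKernel hβ a hv).op (pullE (kL a) (expE (-1) a φ)))
  rw [TemperedKernel.expE_op, ← expE_zero_pullE_kL]
  simp only [kLogDeriv, if_pos]
  rw [(expE_commute_expE _ _ _ _).eq]
  rfl

end

/-! ### The weight of 𝓚: shift of the spectral parameter and integration by parts -/

/-- The part of the kernel of the reflection operator depending only on `y`. -/
def kWeight (α β : ℝ) (v : ℂ) (y : ℝ) : ℂ :=
  Complex.exp (-2 * Complex.I * v * (y : ℂ))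
    * ((1 + β * Real.exp (-y) : ℝ) : ℂ) ^ (-Complex.I * v - (gPar α β : ℂ))
    * ((1 - β * Real.exp (-y) : ℝ) : ℂ) ^ (-Complex.I * v + (gPar α β : ℂ) - 1)

theorem kKernel_eq {n : ℕ} (α β : ℝ) (a : Fin n) (v : ℂ) (x : Fin n → ℝ) (y : ℝ) :
    kKernel α β a v x y = kWeight α β v y * Complex.exp (-(Real.exp (y - x a) : ℂ)) := by
  rw [kKernel, kWeight, sub_eq_add_neg, Complex.exp_add]
  ring

theorem cpow_eq_cpow_sub_one_mul {z : ℂ} (hz : z ≠ 0) (c : ℂ) : z ^ c = z ^ (c - 1) * z := by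
  rw [Complex.cpow_sub _ _ hz, Complex.cpow_one, div_mul_cancel₀ _ hz]

/-- All three exponents change by one unit, and e^{2y}(1+βe^{−y})(1−βe^{−y}) = e^{2y}−β². -/
theorem kWeight_eq {α β : ℝ} (hβ : 0 < β) (v : ℂ) {y : ℝ} (hy : Real.log β < y) :
    kWeight α β v y = kWeight α β (v - Complex.I) y *
      ((Real.exp (2 * y) : ℂ) - (β : ℂ) ^ 2) := by
  have h1 : ((1 + β * Real.exp (-y) : ℝ) : ℂ) ≠ 0 :=
    Complex.ofReal_ne_zero.2 (by positivity)
  have h2 : ((1 - β * Real.exp (-y) : ℝ) : ℂ) ≠ 0 :=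
    Complex.ofReal_ne_zero.2 (one_sub_mul_exp_neg_pos hβ hy).ne'
  have e1 : -Complex.I * (v - Complex.I) - (gPar α β : ℂ) =
      (-Complex.I * v - (gPar α β : ℂ)) - 1 := by linear_combination Complex.I_sq
  have e2 : -Complex.I * (v - Complex.I) + (gPar α β : ℂ) - 1 =
      (-Complex.I * v + (gPar α β : ℂ) - 1) - 1 := by linear_combination Complex.I_sq
  have e3 : Complex.exp (-2 * Complex.I * (v - Complex.I) * (y : ℂ)) =
      Complex.exp (-2 * Complex.I * v * (y : ℂ)) * (Real.exp (-y) : ℂ) ^ 2 := by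
    rw [Complex.ofReal_exp, ← Complex.exp_nat_mul, ← Complex.exp_add]
    congr 1
    push_cast
    linear_combination 2 * (y : ℂ) * Complex.I_sq
  have e4 : (Real.exp (-y) : ℂ) ^ 2 * (Real.exp (2 * y) : ℂ) = 1 := by
    rw [Complex.ofReal_exp, Complex.ofReal_exp, ← Complex.exp_nat_mul, ← Complex.exp_add]
    push_cast
    ring_nf
    exact Complex.exp_zero
  rw [kWeight, kWeight, e1, e2, e3, cpow_eq_cpow_sub_one_mul h1, cpow_eq_cpow_sub_one_mul h2]
  push_cast at *
  linear_combination -(Complex.exp (-2 * Complex.I * v * (y : ℂ)) *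
    (1 + (β : ℂ) * Complex.exp (-(y : ℂ))) ^ (-Complex.I * v - (gPar α β : ℂ) - 1) *
    (1 - (β : ℂ) * Complex.exp (-(y : ℂ))) ^ (-Complex.I * v + (gPar α β : ℂ) - 1 - 1)) * e4

theorem beta_mul_gPar {α β : ℝ} (hβ : 0 < β) :
    (β : ℂ) * (2 * (gPar α β : ℂ) - 1) = 2 * α := by
  have h : β * (2 * gPar α β - 1) = 2 * α := by
    rw [gPar]
    field_simp
    ring
  exact_mod_cast h

/-- The logarithmic derivative is −2iv plus a fraction with denominator e^{2y}−β²; by `kWeight_eq`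
this denominator is absorbed into the weight at v−i. The coefficient of e^y is β(2g−1) = 2α. -/
theorem hasDerivAt_kWeight {α β : ℝ} (hβ : 0 < β) (v : ℂ) {y : ℝ} (hy : Real.log β < y) :
    HasDerivAt (kWeight α β v) (-2 * Complex.I * v * kWeight α β v y +
      (2 * α * (Real.exp y : ℂ) - (β : ℂ) ^ 2 * (1 + 2 * Complex.I * v)) *
        kWeight α β (v - Complex.I) y) y := by
  have p1 : 0 < 1 + β * Real.exp (-y) := by positivity
  have p2 := one_sub_mul_exp_neg_pos hβ hy
  have h1 : ((1 + β * Real.exp (-y) : ℝ) : ℂ) ≠ 0 := Complex.ofReal_ne_zero.2 p1.ne'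
  have h2 : ((1 - β * Real.exp (-y) : ℝ) : ℂ) ≠ 0 := Complex.ofReal_ne_zero.2 p2.ne'
  have e1 : -Complex.I * (v - Complex.I) - (gPar α β : ℂ) =
      (-Complex.I * v - (gPar α β : ℂ)) - 1 := by linear_combination Complex.I_sq
  have e2 : -Complex.I * (v - Complex.I) + (gPar α β : ℂ) - 1 =
      (-Complex.I * v + (gPar α β : ℂ) - 1) - 1 := by linear_combination Complex.I_sq
  have e3 : Complex.exp (-2 * Complex.I * (v - Complex.I) * (y : ℂ)) =
      Complex.exp (-2 * Complex.I * v * (y : ℂ)) * (Real.exp (-y) : ℂ) ^ 2 := by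
    rw [Complex.ofReal_exp, ← Complex.exp_nat_mul, ← Complex.exp_add]
    congr 1
    push_cast
    linear_combination 2 * (y : ℂ) * Complex.I_sq
  have e4 : (Real.exp (-y) : ℂ) * (Real.exp y : ℂ) = 1 := by
    rw [← Complex.ofReal_mul, ← Real.exp_add]
    simp
  have e5 := beta_mul_gPar (α := α) hβ
  have hs : HasDerivAt (fun y => β * Real.exp (-y)) (-(β * Real.exp (-y))) y := by
    simpa using (hasDerivAt_neg y).exp.const_mul β
  have hpow : ∀ {f : ℝ → ℝ} {f' : ℝ} (c : ℂ), HasDerivAt f f' y → 0 < f y →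
      HasDerivAt (fun y => (f y : ℂ) ^ c) (c * (f y : ℂ) ^ (c - 1) * (f' : ℂ)) y := by
    intro f f' c hf hp
    have h := (hasDerivAt_id (f y : ℂ)).cpow_const (c := c) (Complex.ofReal_mem_slitPlane.2 hp)
    have h' := h.comp y hf.ofReal_comp
    exact h'.congr_deriv (by simp)
  have d0 : HasDerivAt (fun y : ℝ => Complex.exp (-2 * Complex.I * v * (y : ℂ)))
      (Complex.exp (-2 * Complex.I * v * (y : ℂ)) * (-2 * Complex.I * v)) y := by
    simpa using ((hasDerivAt_id y).ofReal_comp.const_mul (-2 * Complex.I * v)).cexp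
  have d1 := hpow (-Complex.I * v - (gPar α β : ℂ)) (hs.const_add 1) p1
  have d2 := hpow (-Complex.I * v + (gPar α β : ℂ) - 1) (hs.const_sub 1) p2
  refine ((d0.mul d1).mul d2).congr_deriv ?_
  rw [kWeight, kWeight, e1, e2, e3]
  simp only [Pi.mul_apply]
  rw [cpow_eq_cpow_sub_one_mul h1, cpow_eq_cpow_sub_one_mul h2]
  generalize ((1 + β * Real.exp (-y) : ℝ) : ℂ) ^ (-Complex.I * v - (gPar α β : ℂ) - 1) = P
  generalize ((1 - β * Real.exp (-y) : ℝ) : ℂ) ^ (-Complex.I * v + (gPar α β : ℂ) - 1 - 1) = Q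
  generalize Complex.exp (-2 * Complex.I * v * (y : ℂ)) = E
  simp only [Complex.ofReal_add, Complex.ofReal_sub, Complex.ofReal_mul, Complex.ofReal_neg,
    Complex.ofReal_one]
  generalize (Real.exp (-y) : ℂ) = t at *
  generalize (Real.exp y : ℂ) = s at *
  linear_combination E * P * Q * t * e5 - 2 * α * E * P * Q * t * e4

/-- The integrand is the y-derivative of the kernel times ψ. That product tends to 0 at infinity,
being integrable with integrable derivative, and vanishes at log β. -/
theorem op_kKernel_ibp {n : ℕ} {α β : ℝ} (hβ : 0 < β) (a : Fin n) {u : ℂ}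
    (hu : 1 - gPar α β < u.im) (hv : 0 < u.im + gPar α β)
    (hv' : 0 < (u - Complex.I).im + gPar α β) (ψ : expTempered (n + 1)) :
    (temperedKernel_kKernel hβ a hv).op
        (derivE 0 ψ - (2 * Complex.I * u) • ψ - kLogDeriv a a ψ) +
      (temperedKernel_kKernel hβ a hv').op
        ((2 * α : ℂ) • expE 1 0 ψ - ((β : ℂ) ^ 2 * (1 + 2 * Complex.I * u)) • ψ) = 0 := by
  set hk := temperedKernel_kKernel hβ a hv
  set hk' := temperedKernel_kKernel hβ a hv'
  refine Subtype.ext (funext fun x => ?_)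
  rw [Submodule.coe_add, Pi.add_apply, TemperedKernel.op_apply, TemperedKernel.op_apply,
    ← MeasureTheory.integral_add (hk.integrable _ x) (hk'.integrable _ x)]
  have hd : ∀ y ∈ Set.Ioi (Real.log β),
      HasDerivAt (fun y => kKernel α β a u x y * ψ.1 (Fin.cons y x))
        (kKernel α β a u x y *
          (derivE 0 ψ - (2 * Complex.I * u) • ψ - kLogDeriv a a ψ).1 (Fin.cons y x) +
        kKernel α β a (u - Complex.I) x y * ((2 * α : ℂ) • expE 1 0 ψ -
          ((β : ℂ) ^ 2 * (1 + 2 * Complex.I * u)) • ψ).1 (Fin.cons y x)) y := by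
    intro y hy
    have h1 : HasDerivAt (fun y => (Real.exp (y - x a) : ℂ)) _ y :=
      (((hasDerivAt_id y).sub_const (x a)).exp).ofReal_comp
    have h2 := ((hasDerivAt_kWeight (α := α) hβ u hy).mul (h1.fun_neg.cexp)).mul
      (hasDerivAt_cons ψ x y)
    simp only [kKernel_eq]
    refine h2.congr_deriv ?_
    have e1 : (kLogDeriv a a ψ).1 (Fin.cons y x) =
        (Real.exp (y - x a) : ℂ) * ψ.1 (Fin.cons y x) := by
      simp only [kLogDeriv, if_pos]
      change (Real.exp (1 * y) : ℂ) * ((Real.exp (-1 * x a) : ℂ) * _) = _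
      rw [one_mul, neg_one_mul, sub_eq_add_neg y, Real.exp_add]
      push_cast
      ring
    have e2 : (expE 1 0 ψ).1 (Fin.cons y x) = (Real.exp y : ℂ) * ψ.1 (Fin.cons y x) := by
      change (Real.exp (1 * y) : ℂ) * _ = _
      rw [one_mul]
    simp only [Submodule.coe_sub, Submodule.coe_smul, Pi.sub_apply, Pi.smul_apply, smul_eq_mul,
      e1, e2, Pi.mul_apply, id_eq]
    push_cast
    ring
  have hint : MeasureTheory.IntegrableOn (fun y => kKernel α β a u x y *
          (derivE 0 ψ - (2 * Complex.I * u) • ψ - kLogDeriv a a ψ).1 (Fin.cons y x) +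
        kKernel α β a (u - Complex.I) x y * ((2 * α : ℂ) • expE 1 0 ψ -
          ((β : ℂ) ^ 2 * (1 + 2 * Complex.I * u)) • ψ).1 (Fin.cons y x))
      (Set.Ioi (Real.log β)) := (hk.integrable _ x).add (hk'.integrable _ x)
  -- The real part is Im u + g − 1; its positivity makes the weight continuous and zero at y = log
  -- β.
  have hre : 0 < (-Complex.I * u + (gPar α β : ℂ) - 1).re := by
    simp
    linarith
  have hzero : kKernel α β a u x (Real.log β) = 0 := by
    have h0 : ((1 - β * Real.exp (-Real.log β) : ℝ) : ℂ) = 0 := by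
      rw [Real.exp_neg, Real.exp_log hβ, mul_inv_cancel₀ hβ.ne', sub_self, Complex.ofReal_zero]
    rw [kKernel, h0, Complex.zero_cpow (fun h => by rw [h] at hre; simp at hre), mul_zero]
  have hcont : ContinuousWithinAt (fun y => kKernel α β a u x y * ψ.1 (Fin.cons y x))
      (Set.Ici (Real.log β)) (Real.log β) := by
    refine ContinuousAt.continuousWithinAt (ContinuousAt.mul ?_ (hasDerivAt_cons ψ x _).continuousAt)
    unfold kKernel
    refine ContinuousAt.mul (ContinuousAt.mul ?_ ?_) ?_
    · fun_prop
    · refine ContinuousAt.comp (g := fun t : ℝ => (t : ℂ) ^ (-Complex.I * u - (gPar α β : ℂ)))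
        (Complex.continuousAt_ofReal_cpow_const _ _ (Or.inr ?_)) (by fun_prop)
      positivity
    · exact ContinuousAt.comp
        (g := fun t : ℝ => (t : ℂ) ^ (-Complex.I * u + (gPar α β : ℂ) - 1))
        (Complex.continuousAt_ofReal_cpow_const _ _ (Or.inl hre)) (by fun_prop)
  have hlim := MeasureTheory.tendsto_zero_of_hasDerivAt_of_integrableOn_Ioi hd hint
    (hk.integrable ψ x)
  rw [MeasureTheory.integral_Ioi_of_hasDerivAt_of_tendsto hcont hd hint hlim, hzero]
  simp

section
variable {n : ℕ} {α β : ℝ} (hβ : 0 < β) {a : Fin n} {u : ℂ} (hv : 0 < u.im + gPar α β)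
  (hv' : 0 < (u - Complex.I).im + gPar α β)

theorem kappaE_eq : kappaE hβ a hv =
    kappaE hβ a hv' * (expE (-2) a - algebraMap ℂ _ ((β : ℂ) ^ 2)) := by
  refine LinearMap.ext fun φ => ?_
  have h1 : pullE (kL a) ((expE (-2) a - algebraMap ℂ _ ((β : ℂ) ^ 2)) φ) =
      expE 2 0 (pullE (kL a) φ) - ((β : ℂ) ^ 2) • pullE (kL a) φ := by
    rw [expE_zero_pullE_kL, LinearMap.sub_apply, map_sub, Module.algebraMap_end_apply, map_smul]
  change (temperedKernel_kKernel hβ a hv).op (pullE (kL a) φ) =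
    (temperedKernel_kKernel hβ a hv').op (pullE (kL a)
      ((expE (-2) a - algebraMap ℂ _ ((β : ℂ) ^ 2)) φ))
  rw [h1]
  refine Subtype.ext (funext fun x => ?_)
  rw [TemperedKernel.op_apply, TemperedKernel.op_apply]
  refine MeasureTheory.setIntegral_congr_fun measurableSet_Ioi fun y hy => ?_
  change kKernel α β a u x y * _ = kKernel α β a (u - Complex.I) x y *
    ((Real.exp (2 * y) : ℂ) * _ - (β : ℂ) ^ 2 * _)
  rw [kKernel_eq, kKernel_eq, kWeight_eq hβ u hy]
  ring

/-- This is `op_kKernel_ibp` for ψ = φ(−y): there ∂_y becomes −∂_a and e^y becomes e^{−x_a}. -/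
theorem kappaE_ibp (hu : 1 - gPar α β < u.im) :
    kappaE hβ a hv' * ((2 * α : ℂ) • expE (-1) a -
      algebraMap ℂ _ ((β : ℂ) ^ 2 * (1 + 2 * Complex.I * u))) =
    (2 * Complex.I * u) • kappaE hβ a hv + derivE a * kappaE hβ a hv +
      kappaE hβ a hv * derivE a := by
  refine LinearMap.ext fun φ => ?_
  have h := op_kKernel_ibp hβ a hu hv hv' (pullE (kL a) φ)
  rw [derivE_zero_pullE_kL, expE_zero_pullE_kL, map_sub, map_sub, map_sub,
    ← derivE_kappaE_apply hβ hv] at h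
  simp only [map_neg, map_smul] at h
  simp only [LinearMap.add_apply, LinearMap.smul_apply, Module.End.mul_apply, LinearMap.sub_apply,
    map_sub, map_smul, Module.algebraMap_end_apply]
  rw [← sub_eq_zero, ← h]
  change _ - (_ + derivE a (kappaE hβ a hv φ) + kappaE hβ a hv (derivE a φ)) =
    -kappaE hβ a hv (derivE a φ) - (2 * Complex.I * u) • kappaE hβ a hv φ -
      derivE a (kappaE hβ a hv φ) + ((2 * α : ℂ) • kappaE hβ a hv' (expE (-1) a φ) -
        ((β : ℂ) ^ 2 * (1 + 2 * Complex.I * u)) • kappaE hβ a hv' φ)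
  abel

end

set_option linter.unusedSimpArgs false

/-! ### The algebra of the inductive step -/

/-- The form of a rewriting rule that applies inside right-nested products. -/
theorem mul_mul_of_mul_eq {M : Type*} [Semigroup M] {a b c : M} (h : a * b = c) (x : M) :
    a * (b * x) = c * x := by rw [← mul_assoc, h]

/-- The relations between the derivatives and exponentials in two variables `x_j`, `x_a` and the
operators `R = 𝓡_{ja}(u)`, `R' = 𝓡_{ja}(u - i)`, `S = 𝓡*_{ja}(u)`, `S' = 𝓡*_{ja}(u - i)`. -/
structure BulkRelations {𝒜 : Type*} [Ring 𝒜] [Algebra ℂ 𝒜] (u : ℂ)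
    (dj da ej fj ea fa R R' S S' : 𝒜) : Prop where
  ej_fj : ej * fj = 1
  fj_ej : fj * ej = 1
  ea_fa : ea * fa = 1
  fa_ea : fa * ea = 1
  dj_ej : dj * ej = ej * dj + ej
  dj_fj : dj * fj = fj * dj - fj
  da_ea : da * ea = ea * da + ea
  da_fa : da * fa = fa * da - fa
  dj_da : dj * da = da * dj
  dj_ea : dj * ea = ea * dj
  dj_fa : dj * fa = fa * dj
  ej_da : ej * da = da * ej
  ej_ea : ej * ea = ea * ej
  ej_fa : ej * fa = fa * ej
  fj_da : fj * da = da * fj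
  fj_ea : fj * ea = ea * fj
  fj_fa : fj * fa = fa * fj
  -- The rules for R are oriented so that every operator in x_j, x_a moves to its right.
  ej_R : ej * R = R * ea
  fj_R : fj * R = R * fa
  R'_eq : R' = R * (ea * fj)
  dj_R : dj * R = R * da + (Complex.I * u) • R - R * (ea * fj)
  da_R : da * R = R * dj - (Complex.I * u) • R + R * (ea * fj)
  fa_R : fa * R = R * (dj * fj) - (Complex.I * u) • (R * fj) + R * (ea * (fj * fj))
  dj_S : dj * S = -(S * da) - (Complex.I * u) • S + S'
  S_ea : S * ea = fj * S
  S_eq : S = ea * (ej * (da * S'))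

/-- An element commuting with the operators in the variables `x_j`, `x_a` and with `R`. -/
structure IsInner {𝒜 : Type*} [Ring 𝒜] (dj da ej fj ea fa R x : 𝒜) : Prop where
  dj : dj * x = x * dj
  da : da * x = x * da
  ej : ej * x = x * ej
  fj : fj * x = x * fj
  ea : ea * x = x * ea
  fa : fa * x = x * fa
  R : R * x = x * R

namespace BulkRelations

/-- The product of the row `(t₀, t₁)` with the first column of `(e^{-x_a}, 0; -i∂_{x_a}, 1)`. -/
def rowV {𝒜 : Type*} [Ring 𝒜] [Algebra ℂ 𝒜] (da fa t₀ t₁ : 𝒜) : 𝒜 :=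
  t₀ * fa - Complex.I • (t₁ * da)

/-- The product of the row `(t₀, t₁)` with the column `(e^{-x_a}, 2u - i∂_{x_a})`. -/
def rowW {𝒜 : Type*} [Ring 𝒜] [Algebra ℂ 𝒜] (u : ℂ) (da fa t₀ t₁ : 𝒜) : 𝒜 :=
  rowV da fa t₀ t₁ + (2 * u) • t₁

section
variable {𝒜 : Type*} [Ring 𝒜] [Algebra ℂ 𝒜] {u : ℂ} {dj da ej fj ea fa R R' S S' : 𝒜}
  (h : BulkRelations u dj da ej fj ea fa R R' S S')

/-- The orientation defines a normal form for words: letters in x_a before those in x_j, and within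
each variable exponentials before derivatives. -/
theorem rules (h : BulkRelations u dj da ej fj ea fa R R' S S') :
      (ej * fj = 1 ∧ ∀ x, ej * (fj * x) = x) ∧
      (fj * ej = 1 ∧ ∀ x, fj * (ej * x) = x) ∧
      (ea * fa = 1 ∧ ∀ x, ea * (fa * x) = x) ∧
      (fa * ea = 1 ∧ ∀ x, fa * (ea * x) = x) ∧
      (dj * ej = ej * dj + ej ∧ ∀ x, dj * (ej * x) = (ej * dj + ej) * x) ∧
      (dj * fj = fj * dj - fj ∧ ∀ x, dj * (fj * x) = (fj * dj - fj) * x) ∧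
      (da * ea = ea * da + ea ∧ ∀ x, da * (ea * x) = (ea * da + ea) * x) ∧
      (da * fa = fa * da - fa ∧ ∀ x, da * (fa * x) = (fa * da - fa) * x) ∧
      (dj * da = da * dj ∧ ∀ x, dj * (da * x) = (da * dj) * x) ∧
      (dj * ea = ea * dj ∧ ∀ x, dj * (ea * x) = (ea * dj) * x) ∧
      (dj * fa = fa * dj ∧ ∀ x, dj * (fa * x) = (fa * dj) * x) ∧
      (ej * da = da * ej ∧ ∀ x, ej * (da * x) = (da * ej) * x) ∧
      (ej * ea = ea * ej ∧ ∀ x, ej * (ea * x) = (ea * ej) * x) ∧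
      (ej * fa = fa * ej ∧ ∀ x, ej * (fa * x) = (fa * ej) * x) ∧
      (fj * da = da * fj ∧ ∀ x, fj * (da * x) = (da * fj) * x) ∧
      (fj * ea = ea * fj ∧ ∀ x, fj * (ea * x) = (ea * fj) * x) ∧
      (fj * fa = fa * fj ∧ ∀ x, fj * (fa * x) = (fa * fj) * x) :=
  ⟨⟨h.ej_fj, fun x => by rw [← mul_assoc, h.ej_fj, one_mul]⟩,
    ⟨h.fj_ej, fun x => by rw [← mul_assoc, h.fj_ej, one_mul]⟩,
    ⟨h.ea_fa, fun x => by rw [← mul_assoc, h.ea_fa, one_mul]⟩,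
    ⟨h.fa_ea, fun x => by rw [← mul_assoc, h.fa_ea, one_mul]⟩,
    ⟨h.dj_ej, mul_mul_of_mul_eq h.dj_ej⟩,
    ⟨h.dj_fj, mul_mul_of_mul_eq h.dj_fj⟩,
    ⟨h.da_ea, mul_mul_of_mul_eq h.da_ea⟩,
    ⟨h.da_fa, mul_mul_of_mul_eq h.da_fa⟩,
    ⟨h.dj_da, mul_mul_of_mul_eq h.dj_da⟩,
    ⟨h.dj_ea, mul_mul_of_mul_eq h.dj_ea⟩,
    ⟨h.dj_fa, mul_mul_of_mul_eq h.dj_fa⟩,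
    ⟨h.ej_da, mul_mul_of_mul_eq h.ej_da⟩,
    ⟨h.ej_ea, mul_mul_of_mul_eq h.ej_ea⟩,
    ⟨h.ej_fa, mul_mul_of_mul_eq h.ej_fa⟩,
    ⟨h.fj_da, mul_mul_of_mul_eq h.fj_da⟩,
    ⟨h.fj_ea, mul_mul_of_mul_eq h.fj_ea⟩,
    ⟨h.fj_fa, mul_mul_of_mul_eq h.fj_fa⟩⟩

theorem rules_R (h : BulkRelations u dj da ej fj ea fa R R' S S') :
      (ej * R = R * ea ∧ ∀ x, ej * (R * x) = (R * ea) * x) ∧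
      (fj * R = R * fa ∧ ∀ x, fj * (R * x) = (R * fa) * x) ∧
      (dj * R = R * da + (Complex.I * u) • R - R * (ea * fj) ∧ ∀ x, dj * (R * x) = (R * da + (Complex.I * u) • R - R * (ea * fj)) * x) ∧
      (da * R = R * dj - (Complex.I * u) • R + R * (ea * fj) ∧ ∀ x, da * (R * x) = (R * dj - (Complex.I * u) • R + R * (ea * fj)) * x) ∧
      (fa * R = R * (dj * fj) - (Complex.I * u) • (R * fj) + R * (ea * (fj * fj)) ∧ ∀ x, fa * (R * x) = (R * (dj * fj) - (Complex.I * u) • (R * fj) + R * (ea * (fj * fj))) * x) :=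
  ⟨⟨h.ej_R, mul_mul_of_mul_eq h.ej_R⟩,
    ⟨h.fj_R, mul_mul_of_mul_eq h.fj_R⟩,
    ⟨h.dj_R, mul_mul_of_mul_eq h.dj_R⟩,
    ⟨h.da_R, mul_mul_of_mul_eq h.da_R⟩,
    ⟨h.fa_R, mul_mul_of_mul_eq h.fa_R⟩⟩

theorem rules_inner {t : 𝒜} (h : IsInner dj da ej fj ea fa R t) :
      (dj * t = t * dj ∧ ∀ x, dj * (t * x) = t * (dj * x)) ∧ (da * t = t * da ∧ ∀ x, da * (t * x) = t * (da * x))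
       ∧ (ej * t = t * ej ∧ ∀ x, ej * (t * x) = t * (ej * x)) ∧ (fj * t = t * fj ∧ ∀ x, fj * (t * x) = t * (fj * x))
       ∧ (ea * t = t * ea ∧ ∀ x, ea * (t * x) = t * (ea * x)) ∧ (fa * t = t * fa ∧ ∀ x, fa * (t * x) = t * (fa * x))
       ∧ (R * t = t * R ∧ ∀ x, R * (t * x) = t * (R * x)) := by
  refine ⟨⟨h.dj, fun x => ?_⟩, ⟨h.da, fun x => ?_⟩, ⟨h.ej, fun x => ?_⟩, ⟨h.fj, fun x => ?_⟩,
    ⟨h.ea, fun x => ?_⟩, ⟨h.fa, fun x => ?_⟩, ⟨h.R, fun x => ?_⟩⟩ <;> rw [← mul_assoc, ← mul_assoc]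
  exacts [by rw [h.dj], by rw [h.da], by rw [h.ej], by rw [h.fj], by rw [h.ea], by rw [h.fa],
    by rw [h.R]]

/-- The core of the inductive step. By `da_R` the right side is i∂_a R w: behind R the reflected Lax
matrix of x_j disappears, and the column (e^{−x_a}, −i∂_a) turns into (e^{−x_a}, 2u − i∂_a). -/
theorem rowV_tilde_mul (h : BulkRelations u dj da ej fj ea fa R R' S S') {t₀ t₁ : 𝒜}
    (h₀ : IsInner dj da ej fj ea fa R t₀) (h₁ : IsInner dj da ej fj ea fa R t₁) :
    rowV da fa (t₁ * ej) (-(t₀ * fj) + t₁ * (-(u • 1) + Complex.I • dj)) * R =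
      Complex.I • (R * ((dj - (Complex.I * u) • 1 + ea * fj) * rowW u da fa t₀ t₁)) := by
  simp only [rowV, rowW, mul_add, add_mul, mul_sub, sub_mul, neg_mul, mul_neg, smul_mul_assoc,
    mul_smul_comm, smul_add, smul_sub, smul_neg, smul_smul, mul_one, one_mul, mul_assoc,
    h.rules, h.rules_R, rules_inner h₀, rules_inner h₁]
  match_scalars <;> grind [Complex.I_sq]

/-- The correction to −R w is the contribution of the term −R e^{x_a−x_j} in ∂_j R. -/
theorem tilde_mul (h : BulkRelations u dj da ej fj ea fa R R' S S') {t₀ t₁ : 𝒜}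
    (h₀ : IsInner dj da ej fj ea fa R t₀) (h₁ : IsInner dj da ej fj ea fa R t₁) :
    (-(t₀ * fj) + t₁ * (-(u • 1) + Complex.I • dj)) * R =
      -(R * rowW u da fa t₀ t₁) - Complex.I • (R * (ea * (fj * t₁))) := by
  simp only [rowV, rowW, mul_add, add_mul, mul_sub, sub_mul, neg_mul, mul_neg, smul_mul_assoc,
    mul_smul_comm, smul_add, smul_sub, smul_neg, smul_smul, mul_one, one_mul, mul_assoc,
    h.rules, h.rules_R, rules_inner h₀, rules_inner h₁]
  match_scalars <;> grind [Complex.I_sq]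

theorem row_mul (h : BulkRelations u dj da ej fj ea fa R R' S S') (p q : 𝒜) :
    (u • 1 + Complex.I • dj) * (R * p) + fj * (R * q) =
      R * (Complex.I • (da * p) + fa * q - Complex.I • (ea * (fj * p))) := by
  simp only [mul_add, add_mul, mul_sub, sub_mul, neg_mul, mul_neg, smul_mul_assoc,
    mul_smul_comm, smul_add, smul_sub, smul_neg, smul_smul, mul_one, one_mul, mul_assoc,
    h.rules, h.rules_R]
  match_scalars <;> grind [Complex.I_sq]

theorem rowV_add_mul (x y a b c d : 𝒜) : rowV da fa (x * a + y * c) (x * b + y * d) =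
    x * rowV da fa a b + y * rowV da fa c d := by
  simp only [rowV, mul_add, add_mul, mul_sub, sub_mul, neg_mul, mul_neg, smul_mul_assoc,
    mul_smul_comm, smul_add, smul_sub, smul_neg, smul_smul, mul_one, one_mul, mul_assoc]
  module

theorem rowV_neg_mul (x a b : 𝒜) : rowV da fa (-(x * a)) (-(x * b)) = -(x * rowV da fa a b) := by
  simp only [rowV, mul_add, add_mul, mul_sub, sub_mul, neg_mul, mul_neg, smul_mul_assoc,
    mul_smul_comm, smul_add, smul_sub, smul_neg, smul_smul, mul_one, one_mul, mul_assoc]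
  module

/-- The product of the first row of the Lax matrix in the variable `x_j` with the column
`(t, s)`. -/
def nextTop (u : ℂ) (dj fj t s : 𝒜) : 𝒜 := (u • 1 + Complex.I • dj) * t + fj * s

/-- The second entry of the product of the row `(t₀, t₁)` with the reflected Lax matrix. -/
def tildeSnd (u : ℂ) (dj fj t₀ t₁ : 𝒜) : 𝒜 := -(t₀ * fj) + t₁ * (-(u • 1) + Complex.I • dj)

/-- `i∂_{x_a} w₁ + e^{-x_a} w₂` for the rows `w₁ = rowW A B` and `w₂ = rowW C D`. -/
def opK (u : ℂ) (da fa A B C D : 𝒜) : 𝒜 :=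
  Complex.I • (da * rowW u da fa A B) + fa * rowW u da fa C D

/-- `e^{x_a} (i∂_{x_a} v₁ + e^{-x_a} v₂ + i v₁)` for the rows `v₁ = rowV A B`, `v₂ = rowV C D`. -/
def opH (da ea fa A B C D : 𝒜) : 𝒜 :=
  ea * (Complex.I • (da * rowV da fa A B) + fa * rowV da fa C D + Complex.I • rowV da fa A B)

theorem rowV_next_top (h : BulkRelations u dj da ej fj ea fa R R' S S') {A B C D : 𝒜}
    (hA : IsInner dj da ej fj ea fa R A) (hB : IsInner dj da ej fj ea fa R B)
    (hC : IsInner dj da ej fj ea fa R C) (hD : IsInner dj da ej fj ea fa R D) :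
    rowV da fa (nextTop u dj fj (B * ej) (D * ej))
        (nextTop u dj fj (tildeSnd u dj fj A B) (tildeSnd u dj fj C D)) * R =
      fa * (R * (Complex.I • (ej * opK u da fa A B C D) + ea * rowW u da fa A B)) := by
  rw [nextTop, nextTop, rowV_add_mul, add_mul, mul_assoc, mul_assoc fj, tildeSnd, tildeSnd,
    h.rowV_tilde_mul hA hB, h.rowV_tilde_mul hC hD, ← mul_smul_comm _ R,
    ← mul_smul_comm _ R, h.row_mul,
    opK]
  simp only [mul_add, add_mul, mul_sub, sub_mul, neg_mul, mul_neg, smul_mul_assoc,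
    mul_smul_comm, smul_add, smul_sub, smul_neg, smul_smul, mul_one, one_mul, mul_assoc,
    h.rules, h.rules_R]
  match_scalars <;> grind [Complex.I_sq]

theorem rowV_next_bot (h : BulkRelations u dj da ej fj ea fa R R' S S') {A B : 𝒜}
    (hA : IsInner dj da ej fj ea fa R A) (hB : IsInner dj da ej fj ea fa R B) :
    rowV da fa (-(ej * (B * ej))) (-(ej * tildeSnd u dj fj A B)) * R =
      -(Complex.I • (fa * (R * (ea * (ej * rowW u da fa A B))))) := by
  rw [rowV_neg_mul, neg_mul, mul_assoc, tildeSnd, h.rowV_tilde_mul hA hB]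
  simp only [mul_add, add_mul, mul_sub, sub_mul, neg_mul, mul_neg, smul_mul_assoc,
    mul_smul_comm, smul_add, smul_sub, smul_neg, smul_smul, mul_one, one_mul, mul_assoc,
    h.rules, h.rules_R]
  match_scalars <;> grind [Complex.I_sq]

theorem nextTop_tildeSnd_mul (h : BulkRelations u dj da ej fj ea fa R R' S S') {A B C D : 𝒜}
    (hA : IsInner dj da ej fj ea fa R A) (hB : IsInner dj da ej fj ea fa R B)
    (hC : IsInner dj da ej fj ea fa R C) (hD : IsInner dj da ej fj ea fa R D) :
    nextTop u dj fj (tildeSnd u dj fj A B) (tildeSnd u dj fj C D) * R =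
      R * (-opK u da fa A B C D + Complex.I • (ea * (fj * rowW u da fa A B)) +
        ea * (fj * (da * B + B)) - Complex.I • (fj * D) - ea * (fj * (ea * (fj * B)))) := by
  have e : ∀ w t : 𝒜, -(R * w) - Complex.I • (R * (ea * (fj * t))) =
      R * (-w - Complex.I • (ea * (fj * t))) := fun w t => by
    simp only [mul_sub, mul_neg, mul_smul_comm]
  rw [nextTop, add_mul, mul_assoc, mul_assoc fj, tildeSnd, tildeSnd,
    h.tilde_mul hA hB, h.tilde_mul hC hD, e, e, h.row_mul, opK]
  simp only [mul_add, add_mul, mul_sub, sub_mul, neg_mul, mul_neg, smul_mul_assoc,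
    mul_smul_comm, smul_add, smul_sub, smul_neg, smul_smul, mul_one, one_mul, mul_assoc,
    h.rules, h.rules_R]
  match_scalars <;> grind [Complex.I_sq]

theorem bot_tildeSnd_mul (h : BulkRelations u dj da ej fj ea fa R R' S S') {A B : 𝒜}
    (hA : IsInner dj da ej fj ea fa R A) (hB : IsInner dj da ej fj ea fa R B) :
    -(ej * tildeSnd u dj fj A B) * R =
      R * (ea * rowW u da fa A B + Complex.I • (ea * (ea * (fj * B)))) := by
  rw [neg_mul, mul_assoc, tildeSnd, h.tilde_mul hA hB]
  simp only [mul_add, add_mul, mul_sub, sub_mul, neg_mul, mul_neg, smul_mul_assoc,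
    mul_smul_comm, smul_add, smul_sub, smul_neg, smul_smul, mul_one, one_mul, mul_assoc,
    h.rules, h.rules_R]
  match_scalars <;> grind [Complex.I_sq]

theorem rowW_next_top (h : BulkRelations u dj da ej fj ea fa R R' S S') {A B C D : 𝒜}
    (hA : IsInner dj da ej fj ea fa R A) (hB : IsInner dj da ej fj ea fa R B)
    (hC : IsInner dj da ej fj ea fa R C) (hD : IsInner dj da ej fj ea fa R D) :
    rowW u da fa (nextTop u dj fj (B * ej) (D * ej))
        (nextTop u dj fj (tildeSnd u dj fj A B) (tildeSnd u dj fj C D)) * R =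
      R * (-(u • opK u da fa A B C D) + Complex.I • (dj * opK u da fa A B C D) +
        Complex.I • (fj * opH da ea fa A B C D) +
        ea * (fj * (dj * rowW u da fa A B + (Complex.I * u) • rowW u da fa A B)) +
        ea * (fj * (ea * (fj * rowV da fa A B)))) := by
  rw [rowW, add_mul, h.rowV_next_top hA hB hC hD, smul_mul_assoc,
    h.nextTop_tildeSnd_mul hA hB hC hD, opK, opH, rowW, rowW]
  -- The remaining identity holds for arbitrary v₁ and v₂.
  generalize rowV da fa A B = v₁
  generalize rowV da fa C D = v₂
  simp only [mul_add, add_mul, mul_sub, sub_mul, neg_mul, mul_neg, smul_mul_assoc,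
    mul_smul_comm, smul_add, smul_sub, smul_neg, smul_smul, mul_one, one_mul, mul_assoc,
    h.rules, h.rules_R]
  match_scalars <;> grind [Complex.I_sq]

/-- Here `rowV` and `rowW` drop out: together with `opH_next` this makes the pair `opK`, `opH`
closed under adding a particle, so the first intertwining relation propagates without the second. -/
theorem opK_next (h : BulkRelations u dj da ej fj ea fa R R' S S') {A B C D : 𝒜}
    (hA : IsInner dj da ej fj ea fa R A) (hB : IsInner dj da ej fj ea fa R B)
    (hC : IsInner dj da ej fj ea fa R C) (hD : IsInner dj da ej fj ea fa R D) :
    opK u da fa (nextTop u dj fj (B * ej) (D * ej))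
        (nextTop u dj fj (tildeSnd u dj fj A B) (tildeSnd u dj fj C D))
        (-(ej * (B * ej))) (-(ej * tildeSnd u dj fj A B)) * R =
      -(fa * (R * (ej * (dj * opK u da fa A B C D + (Complex.I * u) • opK u da fa A B C D) +
        opH da ea fa A B C D))) := by
  have e : rowW u da fa (-(ej * (B * ej))) (-(ej * tildeSnd u dj fj A B)) * R =
      -(Complex.I • (fa * (R * (ea * (ej * rowW u da fa A B))))) + (2 * u) •
        (R * (ea * rowW u da fa A B + Complex.I • (ea * (ea * (fj * B))))) := by
    rw [rowW, add_mul, h.rowV_next_bot hA hB, smul_mul_assoc, h.bot_tildeSnd_mul hA hB]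
  rw [opK, add_mul, smul_mul_assoc, mul_assoc, h.rowW_next_top hA hB hC hD, mul_assoc, e]
  generalize opK u da fa A B C D = k
  generalize opH da ea fa A B C D = x
  rw [rowW]
  generalize rowV da fa A B = v₁
  simp only [mul_add, add_mul, mul_sub, sub_mul, neg_mul, mul_neg, smul_mul_assoc,
    mul_smul_comm, smul_add, smul_sub, smul_neg, smul_smul, mul_one, one_mul, mul_assoc,
    h.rules, h.rules_R]
  match_scalars <;> grind [Complex.I_sq]

theorem opH_next (h : BulkRelations u dj da ej fj ea fa R R' S S') {A B C D : 𝒜}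
    (hA : IsInner dj da ej fj ea fa R A) (hB : IsInner dj da ej fj ea fa R B)
    (hC : IsInner dj da ej fj ea fa R C) (hD : IsInner dj da ej fj ea fa R D) :
    opH da ea fa (nextTop u dj fj (B * ej) (D * ej))
        (nextTop u dj fj (tildeSnd u dj fj A B) (tildeSnd u dj fj C D))
        (-(ej * (B * ej))) (-(ej * tildeSnd u dj fj A B)) * R =
      -(fa * (R * (ej * (ej * opK u da fa A B C D)))) := by
  rw [opH, mul_assoc, add_mul, add_mul, smul_mul_assoc, smul_mul_assoc, mul_assoc da,
    mul_assoc fa, h.rowV_next_top hA hB hC hD, h.rowV_next_bot hA hB]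
  generalize opK u da fa A B C D = k
  generalize rowW u da fa A B = w
  simp only [mul_add, add_mul, mul_sub, sub_mul, neg_mul, mul_neg, smul_mul_assoc,
    mul_smul_comm, smul_add, smul_sub, smul_neg, smul_smul, mul_one, one_mul, mul_assoc,
    h.rules]
  simp only [mul_add, add_mul, mul_sub, sub_mul, neg_mul, mul_neg, smul_mul_assoc,
    mul_smul_comm, smul_add, smul_sub, smul_neg, smul_smul, mul_one, one_mul, mul_assoc,
    h.rules, h.rules_R]
  match_scalars <;> grind [Complex.I_sq]

end
end BulkRelations

/-! ### Passage of the intertwining relations through one particle -/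

namespace BulkRelations
section
variable {𝒜 : Type*} [Ring 𝒜] [Algebra ℂ 𝒜] {u : ℂ} {dj da ej fj ea fa R R' S S' : 𝒜}

/-- An operator commuting with the operators in the variable `x_j`. -/
structure CommutesLeft (dj ej fj x : 𝒜) : Prop where
  dj : dj * x = x * dj
  ej : ej * x = x * ej
  fj : fj * x = x * fj

theorem rules_left {x : 𝒜} (h : CommutesLeft dj ej fj x) :
    (dj * x = x * dj ∧ ∀ y, dj * (x * y) = x * (dj * y)) ∧
    (ej * x = x * ej ∧ ∀ y, ej * (x * y) = x * (ej * y)) ∧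
    (fj * x = x * fj ∧ ∀ y, fj * (x * y) = x * (fj * y)) := by
  refine ⟨⟨h.dj, fun y => ?_⟩, ⟨h.ej, fun y => ?_⟩, ⟨h.fj, fun y => ?_⟩⟩ <;>
    rw [← mul_assoc, ← mul_assoc]
  exacts [by rw [h.dj], by rw [h.ej], by rw [h.fj]]

theorem commutesLeft_rowV (h : BulkRelations u dj da ej fj ea fa R R' S S') {A B : 𝒜}
    (hA : IsInner dj da ej fj ea fa R A) (hB : IsInner dj da ej fj ea fa R B) :
    CommutesLeft dj ej fj (rowV da fa A B) := by
  constructor <;>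
  simp only [rowV, mul_add, add_mul, mul_sub, sub_mul, smul_mul_assoc, mul_smul_comm, mul_assoc,
    h.rules, rules_inner hA, rules_inner hB]

theorem commutesLeft_rowW (h : BulkRelations u dj da ej fj ea fa R R' S S') {A B : 𝒜}
    (hA : IsInner dj da ej fj ea fa R A) (hB : IsInner dj da ej fj ea fa R B) :
    CommutesLeft dj ej fj (rowW u da fa A B) := by
  constructor <;>
  simp only [rowW, mul_add, add_mul, smul_mul_assoc, mul_smul_comm,
    rules_left (h.commutesLeft_rowV hA hB), rules_inner hB]

theorem commutesLeft_opK (h : BulkRelations u dj da ej fj ea fa R R' S S') {A B C D : 𝒜}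
    (hA : IsInner dj da ej fj ea fa R A) (hB : IsInner dj da ej fj ea fa R B)
    (hC : IsInner dj da ej fj ea fa R C) (hD : IsInner dj da ej fj ea fa R D) :
    CommutesLeft dj ej fj (opK u da fa A B C D) := by
  constructor <;>
  simp only [opK, mul_add, add_mul, smul_mul_assoc, mul_smul_comm, mul_assoc, h.rules,
    rules_left (h.commutesLeft_rowW hA hB), rules_left (h.commutesLeft_rowW hC hD)]

theorem commutesLeft_opH (h : BulkRelations u dj da ej fj ea fa R R' S S') {A B C D : 𝒜}
    (hA : IsInner dj da ej fj ea fa R A) (hB : IsInner dj da ej fj ea fa R B)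
    (hC : IsInner dj da ej fj ea fa R C) (hD : IsInner dj da ej fj ea fa R D) :
    CommutesLeft dj ej fj (opH da ea fa A B C D) := by
  constructor <;>
  simp only [opH, mul_add, add_mul, smul_mul_assoc, mul_smul_comm, mul_assoc, h.rules,
    rules_left (h.commutesLeft_rowV hA hB), rules_left (h.commutesLeft_rowV hC hD)]

/-- The intertwining relations satisfied by the monodromy matrix with the entries `A, B, C, D` and
the monodromy operators `M` and `M'` with the parameters `u` and `u - i`. -/
structure Intertwines (u : ℂ) (da ea fa : 𝒜) (c : ℂ) (A B C D M M' : 𝒜) : Prop where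
  -- The terms ending in e^{x_a}∂_a vanish on functions independent of x_a. There `snd` is the
  -- exchange relation needed for 𝔻, while `fst` serves to carry `snd` through the induction.
  fst : opK u da fa A B C D * M + opH da ea fa A B C D * M * (ea * da) = 0
  snd : rowW u da fa A B * M + ea * (rowV da fa A B * M) * (ea * da) = c • M'

theorem rules_S (h : BulkRelations u dj da ej fj ea fa R R' S S') :
    dj * S = -(S * da) - (Complex.I * u) • S + S' ∧ (∀ x, S * (ea * x) = fj * (S * x)) :=
  ⟨h.dj_S, fun x => by rw [← mul_assoc, h.S_ea, mul_assoc]⟩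

/-- After the passage through R only the old operators remain, acting on M S. Writing S through S'
produces the right factor e^{x_a}∂_a with which the relations for M can be applied, and the
remaining terms cancel. -/
theorem intertwines_next (h : BulkRelations u dj da ej fj ea fa R R' S S') {A B C D M M' : 𝒜}
    {c : ℂ} (hA : IsInner dj da ej fj ea fa R A) (hB : IsInner dj da ej fj ea fa R B)
    (hC : IsInner dj da ej fj ea fa R C) (hD : IsInner dj da ej fj ea fa R D)
    (hM : CommutesLeft dj ej fj M) (hM' : CommutesLeft dj ej fj M')
    (hi : Intertwines u da ea fa c A B C D M M') :
    Intertwines u da ea fa c (nextTop u dj fj (B * ej) (D * ej))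
      (nextTop u dj fj (tildeSnd u dj fj A B) (tildeSnd u dj fj C D))
      (-(ej * (B * ej))) (-(ej * tildeSnd u dj fj A B)) (R * (M * S)) (R' * (M' * S')) := by
  have hv := h.commutesLeft_rowV hA hB
  have hw := h.commutesLeft_rowW hA hB
  have hk := h.commutesLeft_opK hA hB hC hD
  have hh := h.commutesLeft_opH hA hB hC hD
  obtain ⟨h1, h2⟩ := hi
  have eK := h.opK_next hA hB hC hD
  have eH := h.opH_next hA hB hC hD
  have eV := h.rowV_next_top hA hB hC hD
  have eW := h.rowW_next_top hA hB hC hD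
  generalize opK u da fa A B C D = k at *
  generalize opH da ea fa A B C D = x at *
  generalize rowW u da fa A B = w at *
  generalize rowV da fa A B = v at *
  have key : ∀ y : 𝒜, x * (M * (ea * (da * y))) = -(k * (M * y)) := fun y => by
    have := congrArg (· * y) h1
    simp only [add_mul, zero_mul, mul_assoc] at this
    rw [eq_neg_iff_add_eq_zero, add_comm]
    exact this
  have key2 : ∀ y : 𝒜, ea * (v * (M * (ea * (da * y)))) = c • (M' * y) - w * (M * y) :=
    fun y => by
    have := congrArg (· * y) h2
    simp only [add_mul, smul_mul_assoc, mul_assoc] at this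
    rw [eq_sub_iff_add_eq, add_comm]
    exact this
  -- S = e^{x_a}∂_a(e^{x_j}S') brings in the first relation for M.
  have hS1 : x * (M * S) = -(k * (M * (ej * S'))) := by
    have e : S = ea * (da * (ej * S')) := by
      rw [h.S_eq, ← mul_assoc ej, h.ej_da, mul_assoc]
    rw [e, key]
  have hfS : fj * S = ea * (da * S') := by
    rw [h.S_eq]
    simp only [mul_assoc, h.rules]
  have hS2 : x * (M * (fj * S)) = -(k * (M * S')) := by rw [hfS, key]
  have hS3 : ea * (v * (M * (fj * (fj * S)))) = c • (M' * (fj * S')) - w * (M * (fj * S')) := by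
    have e : fj * (ea * (da * S')) = ea * (da * (fj * S')) := by
      simp only [mul_assoc, h.rules]
    rw [hfS, e, key2]
  constructor
  · rw [← mul_assoc, eK, ← mul_assoc (opH _ _ _ _ _ _ _), eH]
    simp only [mul_add, add_mul, mul_sub, sub_mul, neg_mul, mul_neg, smul_mul_assoc,
      mul_smul_comm, smul_add, smul_sub, smul_neg, smul_smul, mul_assoc, h.rules, h.rules_S,
      rules_left hM, rules_left hk, hS1]
    module
  · rw [← mul_assoc, eW, ← mul_assoc (rowV _ _ _ _), eV, h.R'_eq]
    simp only [mul_add, add_mul, mul_sub, sub_mul, neg_mul, mul_neg, smul_mul_assoc,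
      mul_smul_comm, smul_add, smul_sub, smul_neg, smul_smul, mul_assoc, h.rules, h.rules_S,
      rules_left hM, rules_left hM', rules_left hk, rules_left hw, rules_left hv, rules_left hh,
      hS2, hS3]
    match_scalars <;> grind [Complex.I_sq]

end
end BulkRelations

/-! ### Base of the induction: the boundary -/

namespace BulkRelations

/-- The intertwining relations for the boundary matrix and the reflection operator. -/
theorem intertwines_boundary {𝒜 : Type*} [Ring 𝒜] [Algebra ℂ 𝒜] {u α β : ℂ} {da ea fa κ κ' : 𝒜}
    (hef : ea * fa = 1) (hfe : fa * ea = 1) (hde : da * ea = ea * da + ea)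
    (hdf : da * fa = fa * da - fa) (hκ : κ = κ' * (fa * fa) - (β ^ 2) • κ')
    (hdκ : da * κ = fa * (κ * fa))
    (hibp : (2 * α) • (κ' * fa) - (β ^ 2 * (1 + 2 * Complex.I * u)) • κ' =
      (2 * Complex.I * u) • κ + fa * (κ * fa) + κ * da) :
    Intertwines u da ea fa (2 * (β ^ 2 * (Complex.I * u + 1 / 2) ^ 2 - α ^ 2))
      (algebraMap ℂ 𝒜 (-α)) (algebraMap ℂ 𝒜 (u - Complex.I / 2))
      (algebraMap ℂ 𝒜 (-(β ^ 2 * (u - Complex.I / 2)))) (algebraMap ℂ 𝒜 (-α)) κ κ' := by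
  have hef' : ∀ x, ea * (fa * x) = x := fun x => by rw [← mul_assoc, hef, one_mul]
  have hfe' : ∀ x, fa * (ea * x) = x := fun x => by rw [← mul_assoc, hfe, one_mul]
  have hde' : ∀ x, da * (ea * x) = ea * (da * x) + ea * x := fun x => by
    rw [← mul_assoc, hde, add_mul, mul_assoc]
  have hdf' : ∀ x, da * (fa * x) = fa * (da * x) - fa * x := fun x => by
    rw [← mul_assoc, hdf, sub_mul, mul_assoc]
  have hdκ' : ∀ x, da * (κ * x) = fa * (κ * (fa * x)) := fun x => by
    rw [← mul_assoc, hdκ, mul_assoc, mul_assoc]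
  have ibp : ∀ x, fa * (κ * (fa * x)) = (2 * α) • (κ' * (fa * x)) -
      (β ^ 2 * (1 + 2 * Complex.I * u)) • (κ' * x) - (2 * Complex.I * u) • (κ * x) -
        κ * (da * x) := fun x => by
    have := congrArg (· * x) hibp
    simp only [add_mul, sub_mul, smul_mul_assoc, mul_assoc κ', mul_assoc κ, mul_assoc fa] at this
    rw [add_assoc, ← sub_eq_iff_eq_add'] at this
    rw [eq_sub_iff_add_eq, this]
  have hκ' : ∀ x, κ' * (fa * (fa * x)) = κ * x + (β ^ 2) • (κ' * x) := fun x => by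
    rw [hκ]
    simp only [sub_mul, smul_mul_assoc, mul_assoc]
    abel
  -- `ibp` at e^{x_a}x; the terms with κ'e^{x_a} cancel after expanding κ in κ'.
  have ibp2 : ∀ x, fa * (κ * x) = (2 * α) • (κ' * x) -
      (1 + 2 * Complex.I * u) • (κ' * (fa * x)) - κ * (ea * (da * x)) := fun x => by
    have h1 := ibp (ea * x)
    rw [hfe', hde'] at h1
    have h2 : κ * (ea * x) = κ' * (fa * x) - (β ^ 2) • (κ' * (ea * x)) := by
      rw [hκ]
      simp only [sub_mul, smul_mul_assoc, mul_assoc, hfe']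
    rw [h1, mul_add κ, h2]
    module
  -- `ibp2` at e^{−2x_a}x, with κ'e^{−2x_a} = κ + β²κ'. This eliminates κ', as the first relation
  -- involves κ alone.
  have ibp3 : ∀ x, fa * (κ * (fa * (fa * x))) = (β ^ 2) • (fa * (κ * x)) +
      ((2 * α) • (κ * x) + (1 - 2 * Complex.I * u) • (κ * (fa * x)) - κ * (fa * (da * x)) +
        (β ^ 2) • (κ * (ea * (da * x)))) := fun x => by
    rw [ibp2 (fa * (fa * x)), hκ', hκ', ibp2 x]
    simp only [hdf', hef', mul_sub, mul_add]
    module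
  constructor
  · simp only [opK, opH, rowW, rowV, Algebra.algebraMap_eq_smul_one, mul_add, add_mul, mul_sub,
      sub_mul, neg_mul, mul_neg, smul_mul_assoc, mul_smul_comm, smul_add, smul_sub, smul_neg,
      smul_smul, mul_one, one_mul, mul_assoc, hef, hfe, hde, hdf, hdκ, hef', hfe', hde', hdf',
      hdκ']
    have e1 := ibp3 1
    simp only [mul_one] at e1
    simp only [mul_add, mul_sub, mul_smul_comm, smul_add, smul_sub, smul_smul, ibp3, e1, hfe',
      hdf', hef']
    match_scalars <;> grind [Complex.I_sq]
  · simp only [rowW, rowV, Algebra.algebraMap_eq_smul_one, mul_add, add_mul, mul_sub,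
      sub_mul, neg_mul, mul_neg, smul_mul_assoc, mul_smul_comm, smul_add, smul_sub, smul_neg,
      smul_smul, mul_one, one_mul, mul_assoc, hef, hfe, hde, hdf, hdκ, hef', hfe', hde', hdf',
      hdκ']
    have e1 := ibp2 1
    have e2 := ibp2 fa
    have e3 := hκ' 1
    simp only [mul_one] at e1 e2 e3
    simp only [e1, e2, e3, hdf, mul_sub, hef, hef', mul_one, smul_sub, smul_add, smul_smul]
    match_scalars <;> grind [Complex.I_sq]

end BulkRelations

/-! ### The relations for the actual operators -/

instance instRingEndExpTempered (n : ℕ) : Ring (Module.End ℂ (expTempered n)) :=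
  Module.End.instRing

/-- The operator `𝓡*_{ja}(v)` on `𝓔(ℝⁿ)`. -/
def rStarE {n : ℕ} (j a : Fin n) (v : ℂ) : Module.End ℂ (expTempered n) :=
  reflE j * rE j a v * reflE j

theorem rStarE_coe {n : ℕ} (j a : Fin n) (v : ℂ) (φ : expTempered n) :
    (rStarE j a v φ).1 = rStarOp j a v φ.1 := by
  change (reflE j (rE j a v (reflE j φ))).1 = _
  rw [reflE_coe, rE_coe, reflE_coe]
  rfl

section
variable {n : ℕ} {j a : Fin n}

theorem derivE_commute_rStarE {i : Fin n} (hj : i ≠ j) (ha : i ≠ a) (v : ℂ) :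
    Commute (derivE i) (rStarE j a v) :=
  ((derivE_commute_reflE hj).mul_right (derivE_commute_rE hj ha v)).mul_right
    (derivE_commute_reflE hj)

theorem expE_commute_rStarE {i : Fin n} (hj : i ≠ j) (ha : i ≠ a) (s : ℝ) (v : ℂ) :
    Commute (expE s i) (rStarE j a v) :=
  ((expE_commute_reflE s hj).mul_right (expE_commute_rE hj ha s v)).mul_right
    (expE_commute_reflE s hj)

theorem rE_sub_I_eq (h : j ≠ a) (v : ℂ) :
    rE j a (v - Complex.I) = rE j a v * (expE 1 a * expE (-1) j) := by
  rw [rE_sub_I h, expE_mul_rE, mul_assoc]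

theorem derivE_right_mul_rE_eq (h : j ≠ a) (v : ℂ) :
    derivE a * rE j a v = rE j a v * derivE j - (Complex.I * v) • rE j a v +
      rE j a v * (expE 1 a * expE (-1) j) := by
  rw [rE_mul_derivE_left h, rE_sub_I_eq h]
  abel

/-- From e^{−x_a}R = ∂_a R e^{−x_j}, a rearrangement of `derivE_right_mul_rE`. -/
theorem expE_neg_right_mul_rE (h : j ≠ a) (v : ℂ) :
    expE (-1) a * rE j a v = rE j a v * (derivE j * expE (-1) j) -
      (Complex.I * v) • (rE j a v * expE (-1) j) +
        rE j a v * (expE 1 a * (expE (-1) j * expE (-1) j)) := by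
  have h1 : expE (-1) a * rE j a v = derivE a * rE j a v * expE (-1) j := by
    rw [derivE_right_mul_rE h, mul_assoc, expE_mul_expE_neg, mul_one]
  rw [h1, derivE_right_mul_rE_eq h]
  simp only [add_mul, sub_mul, smul_mul_assoc, mul_assoc]

theorem derivE_mul_rStarE (h : j ≠ a) (v : ℂ) :
    derivE j * rStarE j a v = -(rStarE j a v * derivE a) - (Complex.I * v) • rStarE j a v +
      rStarE j a (v - Complex.I) := by
  have h1 : reflE j * derivE a = derivE a * reflE j := (derivE_commute_reflE h.symm).symm.eq
  rw [rStarE, mul_assoc (reflE j), ← mul_assoc, derivE_mul_reflE_self, neg_mul, mul_assoc,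
    ← mul_assoc (derivE j), derivE_left_mul_rE h, mul_assoc (reflE j), mul_assoc (rE j a v), h1,
    rStarE]
  simp only [add_mul, sub_mul, mul_add, mul_sub, smul_mul_assoc, mul_smul_comm, mul_assoc]
  abel

theorem rStarE_mul_expE (h : j ≠ a) (v : ℂ) :
    rStarE j a v * expE 1 a = expE (-1) j * rStarE j a v := by
  have h1 : reflE j * expE 1 a = expE 1 a * reflE j := (expE_commute_reflE 1 h.symm).symm.eq
  rw [rStarE, mul_assoc, h1, ← mul_assoc, mul_assoc (reflE j), ← expE_mul_rE, ← mul_assoc,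
    ← mul_assoc, ← mul_assoc, expE_mul_reflE_self, neg_neg]

/-- Behind the reflection, ∂_a𝓡(v−i) = e^{−x_a}𝓡(v−i)e^{x_j} = e^{−x_a}e^{x_j}𝓡(v), and r_j turns
e^{x_j} into e^{−x_j}. -/
theorem rStarE_eq (h : j ≠ a) (v : ℂ) :
    rStarE j a v = expE 1 a * (expE 1 j * (derivE a * rStarE j a (v - Complex.I))) := by
  have h1 : derivE a * reflE j = reflE j * derivE a := (derivE_commute_reflE h.symm).eq
  have h2 : reflE j * expE (-1) a = expE (-1) a * reflE j :=
    (expE_commute_reflE (-1) h.symm).symm.eq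
  have h3 : expE 1 j * expE (-1) a = expE (-1) a * expE 1 j :=
    (expE_commute_expE 1 (-1) j a).eq
  have h4 : derivE a * rStarE j a (v - Complex.I) =
      expE (-1) a * (reflE j * expE 1 j * rE j a v * reflE j) := by
    calc derivE a * rStarE j a (v - Complex.I)
        = derivE a * reflE j * rE j a (v - Complex.I) * reflE j := by
          rw [rStarE]; simp only [mul_assoc]
      _ = reflE j * (derivE a * rE j a (v - Complex.I)) * reflE j := by
          rw [h1]; simp only [mul_assoc]
      _ = reflE j * expE (-1) a * expE 1 j * rE j a v * (expE (-1) j * expE 1 j) * reflE j := by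
          rw [derivE_right_mul_rE h, rE_sub_I h]; simp only [mul_assoc]
      _ = _ := by
          rw [expE_neg_mul_expE, mul_one, h2]; simp only [mul_assoc]
  have h5 : expE 1 j * (reflE j * expE 1 j) = reflE j := by
    rw [← mul_assoc, expE_mul_reflE_self, mul_assoc, expE_neg_mul_expE, mul_one]
  calc rStarE j a v = expE 1 j * (reflE j * expE 1 j) * rE j a v * reflE j := by rw [h5, rStarE]
    _ = (expE 1 a * expE (-1) a) * expE 1 j * (reflE j * expE 1 j * rE j a v * reflE j) := by
        rw [expE_mul_expE_neg]; simp only [mul_assoc, one_mul]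
    _ = _ := by
        rw [h4, ← mul_assoc (expE 1 j), h3]; simp only [mul_assoc]

theorem bulkRelations (h : j ≠ a) (u : ℂ) :
    BulkRelations u (derivE j) (derivE a) (expE 1 j) (expE (-1) j) (expE 1 a) (expE (-1) a)
      (rE j a u) (rE j a (u - Complex.I)) (rStarE j a u) (rStarE j a (u - Complex.I)) where
  ej_fj := expE_mul_expE_neg 1 j
  fj_ej := expE_neg_mul_expE 1 j
  ea_fa := expE_mul_expE_neg 1 a
  fa_ea := expE_neg_mul_expE 1 a
  dj_ej := by rw [derivE_mul_expE_self, mul_add]; simp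
  dj_fj := by rw [derivE_mul_expE_self, mul_add]; simp [sub_eq_add_neg]
  da_ea := by rw [derivE_mul_expE_self, mul_add]; simp
  da_fa := by rw [derivE_mul_expE_self, mul_add]; simp [sub_eq_add_neg]
  dj_da := derivE_commute_derivE j a
  dj_ea := derivE_commute_expE 1 h
  dj_fa := derivE_commute_expE (-1) h
  ej_da := (derivE_commute_expE 1 h.symm).symm
  ej_ea := expE_commute_expE _ _ _ _
  ej_fa := expE_commute_expE _ _ _ _
  fj_da := (derivE_commute_expE (-1) h.symm).symm
  fj_ea := expE_commute_expE _ _ _ _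
  fj_fa := expE_commute_expE _ _ _ _
  ej_R := expE_mul_rE 1 u
  fj_R := expE_mul_rE (-1) u
  R'_eq := rE_sub_I_eq h u
  dj_R := by rw [derivE_left_mul_rE h, rE_sub_I_eq h]
  da_R := derivE_right_mul_rE_eq h u
  fa_R := expE_neg_right_mul_rE h u
  dj_S := derivE_mul_rStarE h u
  S_ea := rStarE_mul_expE h u
  S_eq := rStarE_eq h u

end

/-! ### The monodromy matrix -/

theorem sigma2_mul_transpose_mul_sigma2 {𝒜 : Type*} [Ring 𝒜] [Algebra ℂ 𝒜] (a b c d : 𝒜) :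
    sigma2.map (algebraMap ℂ 𝒜) * (!![a, b; c, d]).transpose * sigma2.map (algebraMap ℂ 𝒜) =
      !![d, -b; -c, a] := by
  have hI (x : 𝒜) : Complex.I • Complex.I • x = -x := by
    rw [smul_smul, Complex.I_mul_I, neg_one_smul]
  ext p q : 1
  fin_cases p <;> fin_cases q <;>
    simp [sigma2, Matrix.mul_apply, Algebra.algebraMap_eq_smul_one, hI]

theorem commute_mul_mul_apply {𝒜 : Type*} [Ring 𝒜] {x : 𝒜} {A B C : Matrix (Fin 2) (Fin 2) 𝒜}
    (hA : ∀ p q, Commute x (A p q)) (hB : ∀ p q, Commute x (B p q))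
    (hC : ∀ p q, Commute x (C p q)) (p q : Fin 2) : Commute x ((A * B * C) p q) := by
  simp only [Matrix.mul_apply, Fin.sum_univ_two]
  exact .add_right (.mul_right (.add_right ((hA _ _).mul_right (hB _ _))
    ((hA _ _).mul_right (hB _ _))) (hC _ _)) (.mul_right (.add_right ((hA _ _).mul_right (hB _ _))
    ((hA _ _).mul_right (hB _ _))) (hC _ _))

theorem forall_commute_of {𝒜 : Type*} [Ring 𝒜] {x a b c d : 𝒜} (ha : Commute x a)
    (hb : Commute x b) (hc : Commute x c) (hd : Commute x d) (p q : Fin 2) :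
    Commute x (!![a, b; c, d] p q) := by
  fin_cases p <;> fin_cases q <;> assumption

theorem commute_smul_one_add {𝒜 : Type*} [Ring 𝒜] [Algebra ℂ 𝒜] {x d : 𝒜} (h : Commute x d)
    (u : ℂ) : Commute x (u • 1 + Complex.I • d) :=
  ((Commute.one_right x).smul_right u).add_right (h.smul_right _)

theorem lax_mul_mul {𝒜 : Type*} [Ring 𝒜] [Algebra ℂ 𝒜] (u : ℂ) (dj ej fj : 𝒜)
    (T : Matrix (Fin 2) (Fin 2) 𝒜) :
    !![u • 1 + Complex.I • dj, fj; -ej, 0] * T *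
        !![0, -fj; ej, -(u • 1) + Complex.I • dj] =
      !![BulkRelations.nextTop u dj fj (T 0 1 * ej) (T 1 1 * ej),
          BulkRelations.nextTop u dj fj (BulkRelations.tildeSnd u dj fj (T 0 0) (T 0 1))
            (BulkRelations.tildeSnd u dj fj (T 1 0) (T 1 1));
        -(ej * (T 0 1 * ej)), -(ej * BulkRelations.tildeSnd u dj fj (T 0 0) (T 0 1))] := by
  rw [Matrix.eta_fin_two T, Matrix.mul_fin_two, Matrix.mul_fin_two]
  simp [BulkRelations.nextTop, BulkRelations.tildeSnd, mul_add, add_mul, mul_assoc]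
  constructor <;> abel

section
variable {n : ℕ}

theorem toda_eq (j : Fin n) (u : ℂ) :
    toda j u = !![u • 1 + Complex.I • derivE j, expE (-1) j; -expE 1 j, 0] := by
  rw [toda, Algebra.algebraMap_eq_smul_one]

theorem todaTilde_eq (j : Fin n) (u : ℂ) : todaTilde j u =
    !![0, -expE (-1) j; expE 1 j, -(u • 1) + Complex.I • derivE j] := by
  have h := sigma2_mul_transpose_mul_sigma2 ((-u) • 1 + Complex.I • derivE j) (expE (-1) j)
    (-expE 1 j) (0 : Module.End ℂ (expTempered n))
  rw [neg_smul, neg_neg, ← neg_smul] at h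
  rw [todaTilde, toda_eq]
  rw [neg_smul] at h ⊢
  exact h

/-- The operator `x` commutes with all operators in the first `k` variables. -/
def CommutesFirst (k : ℕ) (x : Module.End ℂ (expTempered n)) : Prop :=
  ∀ i : Fin n, i.val < k → Commute x (derivE i) ∧ ∀ s, Commute x (expE s i)

theorem CommutesFirst.commute_monodromy {α β : ℝ} {u : ℂ} {x : Module.End ℂ (expTempered n)} :
    ∀ {k : ℕ} {hk : k ≤ n}, CommutesFirst k x → ∀ p q, Commute x (monodromy α β u k hk p q)
  | 0, _, _, p, q => (Algebra.commutes (boundaryK α β u p q) x).symm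
  | k + 1, hk, h, p, q => by
    obtain ⟨hd, he⟩ := h ⟨k, hk⟩ (Nat.lt_succ_self k)
    have ht := commute_smul_one_add hd
    refine commute_mul_mul_apply ?_
      (CommutesFirst.commute_monodromy fun i hi => h i (hi.trans k.lt_succ_self)) ?_ p q
    · rw [toda_eq]
      exact forall_commute_of (ht u) (he _) (he _).neg_right (.zero_right _)
    · rw [todaTilde_eq, ← neg_smul]
      exact forall_commute_of (.zero_right _) (he _).neg_right (he _) (ht (-u))

theorem commutesFirst_derivE {k : ℕ} {i : Fin n} (h : k ≤ i.val) : CommutesFirst k (derivE i) :=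
  fun l hl => ⟨derivE_commute_derivE i l, fun s => derivE_commute_expE s (by omega)⟩

theorem commutesFirst_expE {k : ℕ} {i : Fin n} (h : k ≤ i.val) (s : ℝ) :
    CommutesFirst k (expE s i) :=
  fun l hl => ⟨(derivE_commute_expE s (by omega)).symm, fun t => expE_commute_expE s t i l⟩

theorem commutesFirst_rE {k : ℕ} {j a : Fin n} (hj : k ≤ j.val) (ha : k ≤ a.val) (v : ℂ) :
    CommutesFirst k (rE j a v) :=
  fun l hl => ⟨(derivE_commute_rE (by omega) (by omega) v).symm,
    fun s => (expE_commute_rE (by omega) (by omega) s v).symm⟩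

/-- Indices start at 0, so k ≤ j and k ≤ a put x_j and x_a outside the first k particles. -/
theorem isInner_monodromy (α β : ℝ) (u : ℂ) {k : ℕ} (hk : k ≤ n) {j a : Fin n} (hj : k ≤ j.val)
    (ha : k ≤ a.val) (p q : Fin 2) :
    IsInner (derivE j) (derivE a) (expE 1 j) (expE (-1) j) (expE 1 a) (expE (-1) a) (rE j a u)
      (monodromy α β u k hk p q) where
  dj := (commutesFirst_derivE hj).commute_monodromy p q
  da := (commutesFirst_derivE ha).commute_monodromy p q
  ej := (commutesFirst_expE hj 1).commute_monodromy p q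
  fj := (commutesFirst_expE hj (-1)).commute_monodromy p q
  ea := (commutesFirst_expE ha 1).commute_monodromy p q
  fa := (commutesFirst_expE ha (-1)).commute_monodromy p q
  R := (commutesFirst_rE hj ha u).commute_monodromy p q

theorem monodromy_succ (α β : ℝ) (u : ℂ) {k : ℕ} (hk : k + 1 ≤ n) :
    monodromy α β u (k + 1) hk = !![u • 1 + Complex.I • derivE ⟨k, hk⟩, expE (-1) ⟨k, hk⟩;
      -expE 1 ⟨k, hk⟩, 0] * monodromy α β u k (Nat.le_of_succ_le hk) *
        !![0, -expE (-1) ⟨k, hk⟩; expE 1 ⟨k, hk⟩, -(u • 1) + Complex.I • derivE ⟨k, hk⟩] := by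
  rw [monodromy, toda_eq, todaTilde_eq]

/-! ### The monodromy operator -/

/-- The monodromy operator on `𝓔(ℝⁿ)`. -/
def monodromyE {α β : ℝ} (hβ : 0 < β) (a : Fin n) {v : ℂ} (hv : 0 < v.im + gPar α β) :
    (k : ℕ) → k ≤ n → Module.End ℂ (expTempered n)
  | 0, _ => kE hβ a hv
  | k + 1, h =>
      rE ⟨k, h⟩ a v * (monodromyE hβ a hv k (Nat.le_of_succ_le h) * rStarE ⟨k, h⟩ a v)

theorem monodromyE_coe {α β : ℝ} (hβ : 0 < β) (a : Fin n) {v : ℂ} (hv : 0 < v.im + gPar α β) :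
    ∀ (k : ℕ) (h : k ≤ n) (φ : expTempered n),
      (monodromyE hβ a hv k h φ).1 = monodromyOp α β a v k h φ.1
  | 0, _, φ => kE_coe hβ a hv φ
  | k + 1, h, φ => by
    change (rE ⟨k, h⟩ a v (monodromyE hβ a hv k _ (rStarE ⟨k, h⟩ a v φ))).1 = _
    rw [rE_coe, monodromyE_coe, rStarE_coe]
    rfl

theorem derivE_commute_monodromyE {α β : ℝ} (hβ : 0 < β) {a : Fin n} {v : ℂ}
    (hv : 0 < v.im + gPar α β) {i : Fin n} (ha : i ≠ a) :
    ∀ (k : ℕ) (h : k ≤ n), k ≤ i.val → Commute (derivE i) (monodromyE hβ a hv k h)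
  | 0, _, _ => derivE_commute_kE hβ hv ha
  | k + 1, h, hi => by
    have hk : i ≠ ⟨k, h⟩ := (show (⟨k, h⟩ : Fin n) < i from hi).ne'
    exact (derivE_commute_rE hk ha v).mul_right
      ((derivE_commute_monodromyE hβ hv ha k _ (by omega)).mul_right
        (derivE_commute_rStarE hk ha v))

theorem expE_commute_monodromyE {α β : ℝ} (hβ : 0 < β) {a : Fin n} {v : ℂ}
    (hv : 0 < v.im + gPar α β) {i : Fin n} (ha : i ≠ a) (s : ℝ) :
    ∀ (k : ℕ) (h : k ≤ n), k ≤ i.val → Commute (expE s i) (monodromyE hβ a hv k h)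
  | 0, _, _ => expE_commute_kE hβ hv ha s
  | k + 1, h, hi => by
    have hk : i ≠ ⟨k, h⟩ := (show (⟨k, h⟩ : Fin n) < i from hi).ne'
    exact (expE_commute_rE hk ha s v).mul_right
      ((expE_commute_monodromyE hβ hv ha s k _ (by omega)).mul_right
        (expE_commute_rStarE hk ha s v))

theorem commutesLeft_monodromyE {α β : ℝ} (hβ : 0 < β) {a : Fin n} {v : ℂ}
    (hv : 0 < v.im + gPar α β) {i : Fin n} (ha : i ≠ a) {k : ℕ} (h : k ≤ n) (hi : k ≤ i.val) :
    BulkRelations.CommutesLeft (derivE i) (expE 1 i) (expE (-1) i) (monodromyE hβ a hv k h) where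
  dj := derivE_commute_monodromyE hβ hv ha k h hi
  ej := expE_commute_monodromyE hβ hv ha 1 k h hi
  fj := expE_commute_monodromyE hβ hv ha (-1) k h hi

end

/-! ### The normalization of the reflection operator -/

theorem BulkRelations.Intertwines.smul {𝒜 : Type*} [Ring 𝒜] [Algebra ℂ 𝒜] {u c c' s t : ℂ}
    {da ea fa A B C D M M' : 𝒜} (h : Intertwines u da ea fa c A B C D M M') (hs : s * c = c' * t) :
    Intertwines u da ea fa c' A B C D (s • M) (t • M') := by
  constructor
  · rw [mul_smul_comm, mul_smul_comm, smul_mul_assoc, ← smul_add, h.fst, smul_zero]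
  · rw [mul_smul_comm, mul_smul_comm, mul_smul_comm, smul_mul_assoc, ← smul_add, h.snd, smul_smul,
      smul_smul, hs]

/-- The normalization constant of the reflection operator. -/
def kConst (α β : ℝ) (v : ℂ) : ℂ :=
  ((2 * β : ℝ) : ℂ) ^ (Complex.I * v) / Complex.Gamma ((gPar α β : ℂ) - Complex.I * v)

/-- As i(u−i) = iu+1, the power gives 2β; the other factor is Γ(z+1) = zΓ(z) at z = g−iu−1, where Re
z = Im u + g − 1 > 0. -/
theorem kConst_sub_I {α β : ℝ} (hβ : 0 < β) {u : ℂ} (hu : 1 - gPar α β < u.im) :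
    kConst α β (u - Complex.I) =
      2 * β * ((gPar α β : ℂ) - Complex.I * u - 1) * kConst α β u := by
  have h0 : (gPar α β : ℂ) - Complex.I * u - 1 ≠ 0 := fun h => by
    have := congrArg Complex.re h
    simp at this
    linarith
  have e1 : Complex.I * (u - Complex.I) = Complex.I * u + 1 := by
    linear_combination -Complex.I_sq
  have e2 : (gPar α β : ℂ) - (Complex.I * u + 1) = (gPar α β : ℂ) - Complex.I * u - 1 := by ring
  have e3 := Complex.Gamma_add_one _ h0
  rw [sub_add_cancel] at e3
  have h2 : ((2 * β : ℝ) : ℂ) ≠ 0 := by exact_mod_cast (by positivity : 2 * β ≠ 0)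
  have h3 : Complex.Gamma ((gPar α β : ℂ) - Complex.I * u - 1) ≠ 0 := by
    refine Complex.Gamma_ne_zero_of_re_pos ?_
    simp
    linarith
  rw [kConst, kConst, e1, e2, e3, Complex.cpow_add _ _ h2, Complex.cpow_one]
  push_cast
  field_simp

theorem intertwines_kE {n : ℕ} {α β : ℝ} (hβ : 0 < β) (a : Fin n) {u : ℂ}
    (hu : 1 - gPar α β < u.im) (hv : 0 < u.im + gPar α β)
    (hv' : 0 < (u - Complex.I).im + gPar α β) :
    BulkRelations.Intertwines u (derivE a) (expE 1 a) (expE (-1) a)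
      (-(β : ℂ) * ((gPar α β : ℂ) + Complex.I * u))
      (algebraMap ℂ _ (-α : ℂ)) (algebraMap ℂ _ (u - Complex.I / 2))
      (algebraMap ℂ _ (-((β : ℂ) ^ 2 * (u - Complex.I / 2)))) (algebraMap ℂ _ (-α : ℂ))
      (kE hβ a hv) (kE hβ a hv') := by
  have hdκ : derivE a * kappaE hβ a hv = expE (-1) a * (kappaE hβ a hv * expE (-1) a) := by
    rw [derivE_mul_kappaE, mul_assoc]
  refine (BulkRelations.intertwines_boundary (α := α) (β := β) (κ := kappaE hβ a hv)
    (κ' := kappaE hβ a hv') (expE_mul_expE_neg 1 a)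
    (expE_neg_mul_expE 1 a) ?_ ?_ ?_ hdκ ?_).smul (s := kConst α β u)
      (t := kConst α β (u - Complex.I)) ?_
  · rw [derivE_mul_expE_self, mul_add]; simp
  · rw [derivE_mul_expE_self, mul_add]; simp [sub_eq_add_neg]
  · rw [kappaE_eq hβ hv hv', mul_sub, expE_mul_expE, Algebra.algebraMap_eq_smul_one,
      mul_smul_comm, mul_one]
    norm_num
  · have h := kappaE_ibp (a := a) hβ hv hv' hu
    rw [mul_sub, Algebra.algebraMap_eq_smul_one, mul_smul_comm, mul_smul_comm, mul_one, hdκ] at h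
    exact h
  -- With α = β(g−½), the constant β²(iu+½)²−α² equals −β²(g+iu)(g−iu−1); its last factor matches
  -- the ratio of the normalisations.
  · rw [kConst_sub_I hβ hu]
    have h := beta_mul_gPar (α := α) hβ
    have h' : (α : ℂ) = β * (gPar α β - 1 / 2) := by linear_combination -h / 2
    rw [h']
    grind [Complex.I_sq]

theorem intertwines_monodromy {n : ℕ} {α β : ℝ} (hβ : 0 < β) (a : Fin n) {u : ℂ}
    (hu : 1 - gPar α β < u.im) (hv : 0 < u.im + gPar α β)
    (hv' : 0 < (u - Complex.I).im + gPar α β) :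
    ∀ (k : ℕ) (h : k ≤ n), k ≤ a.val →
      BulkRelations.Intertwines u (derivE a) (expE 1 a) (expE (-1) a)
        (-(β : ℂ) * ((gPar α β : ℂ) + Complex.I * u))
        (monodromy α β u k h 0 0) (monodromy α β u k h 0 1)
        (monodromy α β u k h 1 0) (monodromy α β u k h 1 1)
        (monodromyE hβ a hv k h) (monodromyE hβ a hv' k h)
  | 0, _, _ => intertwines_kE hβ a hu hv hv'
  | k + 1, h, ha => by
    have hj : (⟨k, h⟩ : Fin n) ≠ a := fun e => by
      have := congrArg Fin.val e
      simp only at this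
      omega
    have hk : k ≤ a.val := by omega
    have hi := isInner_monodromy α β u (Nat.le_of_succ_le h) (j := ⟨k, h⟩) le_rfl hk
    have := (bulkRelations hj u).intertwines_next (hi 0 0) (hi 0 1) (hi 1 0) (hi 1 1)
      (commutesLeft_monodromyE hβ hv hj _ le_rfl) (commutesLeft_monodromyE hβ hv' hj _ le_rfl)
      (intertwines_monodromy hβ a hu hv hv' k (Nat.le_of_succ_le h) hk)
    rw [monodromy_succ, lax_mul_mul]
    exact this

/-! ### The raising operator -/

theorem derivE_mul_cexpE_self {n : ℕ} (c : ℂ) (j : Fin n) :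
    derivE j * cexpE c j = cexpE c j * derivE j + c • cexpE c j := by
  refine LinearMap.ext fun φ => Subtype.ext ?_
  refine (partialDeriv_cexpMul c j j (differentiable_of_mem φ.2)).trans ?_
  rw [if_pos rfl]
  funext x
  change cexpMul c j (c • φ.1 + partialDeriv j φ.1) x =
    cexpMul c j (partialDeriv j φ.1) x + c * cexpMul c j φ.1 x
  simp only [cexpMul, Pi.add_apply, Pi.smul_apply, smul_eq_mul]
  ring

theorem cexpE_commute_derivE {n : ℕ} (c : ℂ) {i j : Fin n} (h : i ≠ j) :
    Commute (cexpE c j) (derivE i) := by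
  refine Commute.symm (LinearMap.ext fun φ => Subtype.ext ?_)
  refine (partialDeriv_cexpMul c j i (differentiable_of_mem φ.2)).trans ?_
  rw [if_neg h, zero_smul, zero_add]
  rfl

theorem cexpE_commute_expE {n : ℕ} (c : ℂ) (s : ℝ) (i j : Fin n) :
    Commute (cexpE c j) (expE s i) :=
  LinearMap.ext fun _ => Subtype.ext (funext fun _ => mul_left_comm _ _ _)

theorem cexpE_mul_expE {n : ℕ} (c : ℂ) (s : ℝ) (j : Fin n) :
    cexpE c j * expE s j = cexpE (c + s) j := by
  refine LinearMap.ext fun φ => Subtype.ext (funext fun x => ?_)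
  change Complex.exp (c * (x j : ℂ)) * ((Real.exp (s * x j) : ℂ) * φ.1 x) =
    Complex.exp ((c + s) * (x j : ℂ)) * φ.1 x
  rw [add_mul, Complex.exp_add]
  push_cast
  ring

theorem commutesFirst_cexpE {n k : ℕ} (c : ℂ) {a : Fin n} (h : k ≤ a.val) :
    CommutesFirst k (cexpE c a) :=
  fun l hl => ⟨cexpE_commute_derivE c (by omega), fun s => cexpE_commute_expE c s l a⟩

/-- A function of the first `n` variables, as a function of `n + 1` variables. -/
def extendE {n : ℕ} (φ : expTempered n) : expTempered (n + 1) := pullE (coordL Fin.castSucc) φ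

theorem derivE_last_extendE {n : ℕ} (φ : expTempered n) : derivE (Fin.last n) (extendE φ) = 0 :=
  derivE_pullE_coordL_eq_zero _ _ _ fun l => (Fin.castSucc_lt_last l).ne

theorem raising_eq {n : ℕ} {α β : ℝ} (hβ : 0 < β) {v : ℂ} (hv : 0 < v.im + gPar α β)
    (φ : expTempered n) : raising α β n v φ.1 =
      (cexpE (Complex.I * v) (Fin.last n)
        (monodromyE hβ (Fin.last n) hv n (Nat.le_succ n) (extendE φ))).1 := by
  change _ = cexpMul (Complex.I * v) (Fin.last n)
    (monodromyE hβ (Fin.last n) hv n (Nat.le_succ n) (extendE φ)).1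
  rw [monodromyE_coe]
  rfl

/-- Moving E = e^{iux_a} to the left replaces i∂_a by i∂_a − u, so −u + i∂_a becomes −(2u − i∂_a).
-/
theorem tildeSnd_mul_cexp {𝒜 : Type*} [Ring 𝒜] [Algebra ℂ 𝒜] {u : ℂ} {da ea fa A B E : 𝒜}
    (hA : E * A = A * E) (hB : E * B = B * E) (he : E * ea = ea * E) (hf : E * fa = fa * E)
    (hd : da * E = E * da + (Complex.I * u) • E) :
    -(ea * BulkRelations.tildeSnd u da fa A B) * E =
      E * ea * BulkRelations.rowW u da fa A B := by
  rw [he]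
  simp only [BulkRelations.tildeSnd, BulkRelations.rowW, BulkRelations.rowV, mul_add, add_mul,
    mul_sub, neg_mul, mul_neg, smul_mul_assoc, mul_smul_comm, mul_assoc, hd, ← hf,
    mul_one]
  simp only [← mul_assoc E, hA, hB]
  simp only [mul_assoc, smul_add, smul_smul, neg_add, sub_eq_add_neg]
  match_scalars <;> grind [Complex.I_sq]

theorem opD_mul_cexpE (α β : ℝ) (n : ℕ) (u : ℂ) :
    opD α β (n + 1) u * cexpE (Complex.I * u) (Fin.last n) =
      cexpE (Complex.I * u) (Fin.last n) * expE 1 (Fin.last n) *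
        BulkRelations.rowW u (derivE (Fin.last n)) (expE (-1) (Fin.last n))
          (monodromy α β u n (Nat.le_succ n) 0 0) (monodromy α β u n (Nat.le_succ n) 0 1) := by
  have hE := (commutesFirst_cexpE (k := n) (Complex.I * u)
    (a := Fin.last n) le_rfl).commute_monodromy (α := α) (β := β) (u := u) (hk := Nat.le_succ n)
  rw [opD, monodromy_succ, lax_mul_mul]
  exact tildeSnd_mul_cexp (hE 0 0) (hE 0 1) (cexpE_commute_expE _ _ _ _)
    (cexpE_commute_expE _ _ _ _) (derivE_mul_cexpE_self _ _)

theorem opD_raising {n : ℕ} {α β : ℝ} (hβ : 0 < β) {u : ℂ} (hu : 1 - gPar α β < u.im)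
    (hv : 0 < u.im + gPar α β) (hv' : 0 < (u - Complex.I).im + gPar α β) (φ : expTempered n) :
    opD α β (n + 1) u (cexpE (Complex.I * u) (Fin.last n)
        (monodromyE hβ (Fin.last n) hv n (Nat.le_succ n) (extendE φ))) =
      (-(β : ℂ) * ((gPar α β : ℂ) + Complex.I * u)) •
        cexpE (Complex.I * (u - Complex.I)) (Fin.last n)
          (monodromyE hβ (Fin.last n) hv' n (Nat.le_succ n) (extendE φ)) := by
  have h1 := LinearMap.congr_fun (intertwines_monodromy hβ (Fin.last n) hu hv hv' n
    (Nat.le_succ n) le_rfl).snd (extendE φ)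
  simp only [LinearMap.add_apply, Module.End.mul_apply, derivE_last_extendE, map_zero, add_zero,
    LinearMap.smul_apply] at h1
  have h2 := LinearMap.congr_fun (opD_mul_cexpE α β n u)
    (monodromyE hβ (Fin.last n) hv n (Nat.le_succ n) (extendE φ))
  simp only [Module.End.mul_apply] at h2
  -- The factor e^{x_a} left over from the Lax matrix supplies the shift u ↦ u−i in the exponential
  -- prefactor.
  have e : Complex.I * (u - Complex.I) = Complex.I * u + (1 : ℝ) := by
    push_cast
    linear_combination -Complex.I_sq
  rw [h2, h1, map_smul, map_smul, e, ← cexpE_mul_expE]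
  rfl

theorem raisingWellDefined {α β : ℝ} (hβ : 0 < β) (n : ℕ) {v : ℂ} (hv : 0 < v.im + gPar α β) :
    RaisingWellDefined α β n v := by
  refine fun ψ hψ => ⟨⟨integrableOn_kIntegrand hβ _ hv ⟨ψ, hψ⟩, ?_⟩,
    fun j => ⟨integrable_rIntegrand _ _ v ⟨ψ, hψ⟩, ?_⟩⟩
  · rw [← kE_coe hβ (Fin.last n) hv ⟨ψ, hψ⟩]
    exact Subtype.property _
  · rw [← rE_coe j.castSucc (Fin.last n) v ⟨ψ, hψ⟩]
    exact Subtype.property _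

end BCToda
end

theorem mainTheorem6 (α β : ℝ) (hβ : 0 < β) (hg : 0 < BCToda.gPar α β) (n : ℕ) (u : ℂ)
    (hu : 1 - BCToda.gPar α β < u.im) :
    BCToda.RaisingWellDefined α β n u ∧
    BCToda.RaisingWellDefined α β n (u - Complex.I) ∧
    ∀ φ ∈ BCToda.expTempered n,
      ∃ (h : BCToda.raising α β n u φ ∈ BCToda.expTempered (n + 1))
        (h' : BCToda.raising α β n (u - Complex.I) φ ∈ BCToda.expTempered (n + 1)),
        BCToda.opD α β (n + 1) u ⟨BCToda.raising α β n u φ, h⟩ =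
          (-(β : ℂ) * ((BCToda.gPar α β : ℂ) + Complex.I * u)) •
            ⟨BCToda.raising α β n (u - Complex.I) φ, h'⟩ := by
  have hv : 0 < u.im + BCToda.gPar α β := by linarith
  -- Convergence at u−i is exactly the condition Im u > 1−g.
  have hv' : 0 < (u - Complex.I).im + BCToda.gPar α β := by
    rw [Complex.sub_im, Complex.I_im]
    linarith
  refine ⟨BCToda.raisingWellDefined hβ n hv, BCToda.raisingWellDefined hβ n hv', fun φ hφ => ?_⟩
  have e := BCToda.raising_eq hβ hv ⟨φ, hφ⟩
  have e' := BCToda.raising_eq hβ hv' ⟨φ, hφ⟩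
  have h := BCToda.opD_raising hβ hu hv hv' ⟨φ, hφ⟩
  generalize BCToda.cexpE (Complex.I * u) _ _ = X at e h
  generalize BCToda.cexpE (Complex.I * (u - Complex.I)) _ _ = X' at e' h
  have hX : BCToda.raising α β n u φ ∈ BCToda.expTempered (n + 1) := e ▸ X.2
  have hX' : BCToda.raising α β n (u - Complex.I) φ ∈ BCToda.expTempered (n + 1) := e' ▸ X'.2
  have e1 : ⟨_, hX⟩ = X := Subtype.ext e
  have e2 : ⟨_, hX'⟩ = X' := Subtype.ext e'
  exact ⟨hX, hX', by rw [e1, e2, h]⟩
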